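/- Write $M_2$ for the complex $2\times 2$ matrices. A qubit channel is a completely positive, trace preserving linear map $Q:M_2\to M_2$. Every qubit channel acts as $$X\mapsto X_{11}Q_{11}+X_{12}Q_{12}+X_{21}Q_{12}^{*}+X_{22}Q_{22},$$ $$Q_{11}=\begin{pmatrix}a&b\\ \bar b&1-a\end{pmatrix},\quad Q_{12}=\begin{pmatrix}c&d\\ e&-c\end{pmatrix},\quad Q_{22}=\begin{pmatrix}f&g\\ \bar g&1-f\end{pmatrix},$$ for unique $a,f\in\mathbb R$ and $b,c,d,e,g\in\mathbb C$. Let $\mathcal Q\subset\mathbb R^2\times\mathbb C^5\cong\mathbb R^{12}$ be the set of the parameters $(a,f,b,c,d,e,g)$ of all qubit channels, and let $Q$ be random with the uniform distribution on $\mathcal Q$, that is, normalized Lebesgue measure on $\mathcal Q$. Let $v\in\mathbb R^3$ be the Bloch vector of the image of the maximally mixed state, so that $Q(\tfrac12 I)=\tfrac12(I+v_1\sigma_1+v_2\sigma_2+v_3\sigma_3)$ with the Pauli matrices $\sigma_1,\sigma_2,\sigma_3$. Then: 1. the Bloch radius $\|v\|_2$ has the density, with respect to Lebesgue measure, $\kappa(r)=40\,r^2(1-r)^6(r^3+6r^2+12r+2)$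 for $r\in[0,1]$, and $0$ outside $[0,1]$; 2. the $z$-component $v_3$ has the density $\eta(z)=\tfrac{20}{11}\bigl(z^4+7|z|^3+17z^2+7|z|+1\bigr)(1-|z|)^7$ for $z\in[-1,1]$, and $0$ outside $[-1,1]$; 3. the distribution of $v$ is rotation invariant: $Ov$ has the same distribution as $v$ for every $O\in SO(3)$. -/

import Mathlib

open MeasureTheory
open scoped ComplexOrder CStarAlgebra

namespace QubitChannel

/-- The algebra of complex two by two matrices. -/
abbrev M2 : Type := Matrix (Fin 2) (Fin 2) ℂ

/-- A qubit channel: a completely positive and trace preserving linear map on the two by two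
matrices. Complete positivity is Mathlib's notion for C⋆-algebras; `CStarMatrix` is the type of
matrices carrying its C⋆-algebra structure. -/
structure IsQubitChannel (Φ : M2 →ₗ[ℂ] M2) : Prop where
  completelyPositive :
    ∃ Ψ : CStarMatrix (Fin 2) (Fin 2) ℂ →CP CStarMatrix (Fin 2) (Fin 2) ℂ,
      ∀ X : M2, Ψ (CStarMatrix.ofMatrix X) = CStarMatrix.ofMatrix (Φ X)
  tracePreserving : ∀ X : M2, (Φ X).trace = X.trace

/-- The linear map with Choi block matrix `C`, that is
`X ↦ X₁₁ C₁₁ + X₁₂ C₁₂ + X₂₁ C₂₁ + X₂₂ C₂₂`. -/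
def choiMap (C : Matrix (Fin 2) (Fin 2) M2) : M2 →ₗ[ℂ] M2 where
  toFun X := ∑ i, ∑ j, X i j • C i j
  map_add' X Y := by simp only [Matrix.add_apply, add_smul, Finset.sum_add_distrib]
  map_smul' t X := by
    simp only [Matrix.smul_apply, smul_eq_mul, mul_smul, Finset.smul_sum, RingHom.id_apply]

/-- The coordinates `(a, f, b, c, d, e, g)` of a Choi matrix, twelve real parameters in all. Its
`volume` is the product measure, that is Lebesgue measure on `ℝ¹²`. -/
abbrev Param : Type := ℝ × ℝ × ℂ × ℂ × ℂ × ℂ × ℂ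

/-- The Choi block matrix with the given coordinates. -/
def choiBlocks : Param → Matrix (Fin 2) (Fin 2) M2 := fun (a, f, b, c, d, e, g) =>
  !![!![(a : ℂ), b; star b, 1 - (a : ℂ)],  !![c, d; e, -c];
     !![star c, star e; star d, -star c],  !![(f : ℂ), g; star g, 1 - (f : ℂ)]]

/-- The linear map on two by two matrices with the given coordinates. -/
def ofParam (p : Param) : M2 →ₗ[ℂ] M2 := choiMap (choiBlocks p)

/-- The space of qubit channels, as a subset of `ℝ¹²`. -/
def channels : Set Param := {p | IsQubitChannel (ofParam p)}

/-- Completely positive maps commute with the involution. -/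
theorem completelyPositive_map_star {A B : Type*} [NonUnitalCStarAlgebra A]
    [NonUnitalCStarAlgebra B] [PartialOrder A] [PartialOrder B] [StarOrderedRing A]
    [StarOrderedRing B] (Ψ : A →CP B) (x : A) : Ψ (star x) = star (Ψ x) :=
  map_star Ψ x

/-- Every qubit channel has exactly one system of coordinates. -/
theorem existsUnique_param {Φ : M2 →ₗ[ℂ] M2} (hΦ : IsQubitChannel Φ) :
    ∃! p : Param, ofParam p = Φ := by
  have hs : ∀ X : M2, Φ (star X) = star (Φ X) := by
    obtain ⟨Ψ, hΨ⟩ := hΦ.completelyPositive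
    intro X
    have h := completelyPositive_map_star Ψ (CStarMatrix.ofMatrix X)
    have h2 : star (CStarMatrix.ofMatrix X) = CStarMatrix.ofMatrix (star X) := rfl
    rw [h2, hΨ, hΨ] at h
    exact h
  have hdec : ∀ X : M2, Φ X = ∑ i, ∑ j, X i j • Φ (Matrix.single i j 1) := by
    intro X
    conv_lhs => rw [Matrix.matrix_eq_sum_single X]
    simp only [map_sum, ← map_smul, Matrix.smul_single, smul_eq_mul, mul_one]
  have h00 := hs (Matrix.single 0 0 1)
  have h01 := hs (Matrix.single 0 1 1)
  have h11 := hs (Matrix.single 1 1 1)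
  have t00 := hΦ.tracePreserving (Matrix.single 0 0 1)
  have t01 := hΦ.tracePreserving (Matrix.single 0 1 1)
  have t11 := hΦ.tracePreserving (Matrix.single 1 1 1)
  simp only [Matrix.star_eq_conjTranspose, Matrix.conjTranspose_single, star_one] at h00 h01 h11
  simp only [Matrix.trace_fin_two, Matrix.single_apply] at t00 t01 t11
  have him : ∀ z : ℂ, z = star z → ((z.re : ℝ) : ℂ) = z := fun z hz =>
    Complex.conj_eq_iff_re.mp hz.symm
  have a0 := him _ (congrFun (congrFun h00 0) 0)
  have f0 := him _ (congrFun (congrFun h11 0) 0)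
  refine ⟨((Φ (Matrix.single 0 0 1) 0 0).re, (Φ (Matrix.single 1 1 1) 0 0).re,
    Φ (Matrix.single 0 0 1) 0 1, Φ (Matrix.single 0 1 1) 0 0, Φ (Matrix.single 0 1 1) 0 1,
    Φ (Matrix.single 0 1 1) 1 0, Φ (Matrix.single 1 1 1) 0 1), ?_, ?_⟩
  · refine LinearMap.ext fun X => ?_
    rw [hdec X]
    change ∑ i, ∑ j, X i j • choiBlocks _ i j = _
    have hC : ∀ i j, choiBlocks ((Φ (Matrix.single 0 0 1) 0 0).re,
        (Φ (Matrix.single 1 1 1) 0 0).re,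
        Φ (Matrix.single 0 0 1) 0 1, Φ (Matrix.single 0 1 1) 0 0, Φ (Matrix.single 0 1 1) 0 1,
        Φ (Matrix.single 0 1 1) 1 0, Φ (Matrix.single 1 1 1) 0 1) i j =
        Φ (Matrix.single i j 1) := by
      have e1 := congrFun (congrFun h00 1) 0
      have e2 := congrFun (congrFun h11 1) 0
      simp only [Matrix.conjTranspose_apply] at e1 e2
      norm_num at t00 t01 t11
      have m00 : 1 - (((Φ (Matrix.single 0 0 1) 0 0).re : ℝ) : ℂ) =
          Φ (Matrix.single 0 0 1) 1 1 := by
        rw [a0]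
        linear_combination -t00
      have m11 : 1 - (((Φ (Matrix.single 1 1 1) 0 0).re : ℝ) : ℂ) =
          Φ (Matrix.single 1 1 1) 1 1 := by
        rw [f0]
        linear_combination -t11
      have m01 : -Φ (Matrix.single 0 1 1) 0 0 = Φ (Matrix.single 0 1 1) 1 1 := by
        linear_combination -t01
      have m10 : -star (Φ (Matrix.single 0 1 1) 0 0) = star (Φ (Matrix.single 0 1 1) 1 1) := by
        rw [← m01, star_neg]
      intro i j
      fin_cases i <;> fin_cases j
      · ext k l
        fin_cases k <;> fin_cases l
        · exact a0
        · rfl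
        · exact e1.symm
        · exact m00
      · ext k l
        fin_cases k <;> fin_cases l
        · rfl
        · rfl
        · rfl
        · exact m01
      · change !![_, _; _, _] = Φ (Matrix.single 1 0 1)
        rw [h01]
        ext k l
        fin_cases k <;> fin_cases l
        · rfl
        · rfl
        · rfl
        · exact m10
      · ext k l
        fin_cases k <;> fin_cases l
        · exact f0
        · rfl
        · exact e2.symm
        · exact m11
    simp only [hC]
  · rintro ⟨a, f, b, c, d, e, g⟩ rfl
    simp [ofParam, choiMap, choiBlocks, Fin.sum_univ_succ]

/-- The uniform distribution on the space of qubit channels: Lebesgue measure restricted to it and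
normalized. -/
noncomputable def uniform : Measure Param := ProbabilityTheory.cond volume channels

/-- The Pauli matrices `σ₁, σ₂, σ₃`. -/
noncomputable def pauli : Fin 3 → M2 :=
  ![!![0, 1; 1, 0], !![0, -Complex.I; Complex.I, 0], !![1, 0; 0, -1]]

/-- The Stokes parametrization `x ↦ (I + x · σ) / 2`. -/
noncomputable def stokes (x : EuclideanSpace ℝ (Fin 3)) : M2 :=
  (1 / 2 : ℂ) • (1 + ∑ j, (x j : ℂ) • pauli j)

/-- The Bloch vector of a matrix, with coordinates `Tr (ρ σⱼ)`. -/
noncomputable def bloch (ρ : M2) : EuclideanSpace ℝ (Fin 3) :=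
  WithLp.toLp 2 fun j => ((ρ * pauli j).trace).re

/-- `bloch` inverts the Stokes parametrization. -/
theorem bloch_stokes (x : EuclideanSpace ℝ (Fin 3)) : bloch (stokes x) = x := by
  ext j
  fin_cases j <;>
    simp [bloch, stokes, pauli, Matrix.trace, Fin.sum_univ_succ, Matrix.mul_apply,
      Matrix.one_apply] <;> ring

/-- The maximally mixed state `I / 2`. -/
noncomputable def maximallyMixed : M2 := (1 / 2 : ℂ) • 1

/-- The Bloch vector of the image of the maximally mixed state. -/
noncomputable def outBloch (p : Param) : EuclideanSpace ℝ (Fin 3) :=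
  bloch (ofParam p maximallyMixed)

end QubitChannel

/-! Sort the Choi matrix by output index. Trace preservation then gives it the block form with
diagonal blocks `A` and `1 - A` and off-diagonal blocks `B` and `B*`, where `A` has diagonal `a`,
`f` and corner `c`, and `B` carries `b`, `d`, `e`, `g`. Complete positivity is positive
semidefiniteness of this matrix (`mem_channels`).

For `0 < A < 1` write `A = L*L` and `1 - A = R*R`. The admissible `B` are exactly `L*KR` with `K` a
contraction, so the slice over `A` has volume `det(A)² det(1 - A)²` times a constant, the volume of
the set of contractions (`volume_slice`). That constant only has to be finite and nonzero, since it
cancels on normalization. As `v₃ = tr A - 1`, fixing `z = v₃` leaves the traceless part of `A`,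
which ranges over a ball of radius `(1 - |z|)/2` in `ℝ³`. Integrating the weight over this ball
gives `π/25200 · η(z)` (`lintegral_sliceWeight`), hence the law of `v₃` (`map_outBloch_two`).

Conjugating the output by a Hermitian unitary `U` maps channels to channels and is an affine
involution of `ℝ¹²`, so it preserves volume. It turns `v` by a half-turn, and some half-turn takes
any given unit vector `u` to the third axis. Hence every marginal `⟨v, u⟩` has density `η`
(`map_inner_outBloch`).

The spherically symmetric law with density `ρ(r) = κ(r)/(4πr²)` also has `η` as its marginal in
every direction, because `η'(r) = -2πrρ(r)` for `0 < r < 1` and `η(1) = 0`. A law on `ℝ³` is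
determined by its one-dimensional marginals (Cramér–Wold, via characteristic functions), so `v` has
this law (`map_outBloch`). The radial density and the rotation invariance are read off from it. -/

namespace QubitChannel

/-! ### Polar coordinates and the fundamental theorem of calculus for nonnegative integrands -/

section RadialIntegrals
open Set Module Measure

/-- Polar coordinates split `E` without the origin into the unit sphere and a half-line; the factor
`finrank ℝ E * μ (ball 0 1)` is the mass of the sphere. -/
theorem lintegral_fun_norm_addHaar {E : Type*} [NormedAddCommGroup E] [NormedSpace ℝ E]
    [FiniteDimensional ℝ E] [Nontrivial E] [MeasurableSpace E] [BorelSpace E]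
    (μ : Measure E) [μ.IsAddHaarMeasure] {f : ℝ → ENNReal} (hf : Measurable f) :
    ∫⁻ x, f ‖x‖ ∂μ = finrank ℝ E * μ (Metric.ball 0 1) *
      ∫⁻ y in Ioi (0 : ℝ), ENNReal.ofReal (y ^ (finrank ℝ E - 1)) * f y := by
  calc
    ∫⁻ x, f ‖x‖ ∂μ = ∫⁻ x : ({(0)}ᶜ : Set E), f ‖x.1‖ ∂(μ.comap (↑)) := by
      rw [lintegral_subtype_comap (measurableSet_singleton _).compl fun x ↦ f ‖x‖,
        restrict_compl_singleton]
    _ = ∫⁻ x, f x.2 ∂μ.toSphere.prod (.volumeIoiPow (finrank ℝ E - 1)) := by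
      simpa using (μ.measurePreserving_homeomorphUnitSphereProd.lintegral_comp_emb
        (Homeomorph.measurableEmbedding _) (f ∘ Subtype.val ∘ Prod.snd))
    _ = μ.toSphere univ * ∫⁻ x : Ioi (0 : ℝ), f x ∂.volumeIoiPow (finrank ℝ E - 1) := by
      rw [lintegral_prod _ (by fun_prop)]
      simp [mul_comm]
    _ = _ := by
      rw [toSphere_apply_univ, volumeIoiPow,
        lintegral_withDensity_eq_lintegral_mul _ (by fun_prop) (by fun_prop)]
      congr 1
      exact lintegral_subtype_comap measurableSet_Ioi
        (fun y => ENNReal.ofReal (y ^ (finrank ℝ E - 1)) * f y)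

theorem lintegral_fun_norm_complex {f : ℝ → ENNReal} (hf : Measurable f) :
    ∫⁻ w : ℂ, f ‖w‖ =
      ENNReal.ofReal (2 * Real.pi) * ∫⁻ y in Ioi (0 : ℝ), ENNReal.ofReal y * f y := by
  rw [lintegral_fun_norm_addHaar volume hf, Complex.finrank_real_complex, Complex.volume_ball]
  simp only [pow_one, Nat.add_one_sub_one, ENNReal.ofReal_one, one_pow, one_mul]
  congr 1
  rw [ENNReal.ofReal_mul (by norm_num)]
  congr 1
  · simp
  · rw [← NNReal.coe_real_pi, ENNReal.ofReal_coe_nnreal]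

/-- A nonnegative derivative of a function continuous up to the endpoints is automatically
integrable, so no integrability hypothesis is needed. -/
theorem lintegral_Ioo_eq_sub_of_hasDerivAt {F f : ℝ → ℝ} {a b : ℝ} (hab : a ≤ b)
    (hF : ContinuousOn F (Icc a b)) (hd : ∀ y ∈ Ioo a b, HasDerivAt F (f y) y)
    (h0 : ∀ y ∈ Ioo a b, 0 ≤ f y) :
    ∫⁻ y in Ioo a b, ENNReal.ofReal (f y) = ENNReal.ofReal (F b - F a) := by
  have hi : IntegrableOn f (Ioc a b) :=
    intervalIntegral.integrableOn_deriv_of_nonneg hF hd h0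
  have hi' : IntegrableOn f (Ioo a b) := hi.mono_set Ioo_subset_Ioc_self
  rw [← ofReal_integral_eq_lintegral_ofReal hi'
    ((ae_restrict_iff' measurableSet_Ioo).2 (.of_forall h0)),
    ← integral_Ioc_eq_integral_Ioo, ← intervalIntegral.integral_of_le hab,
    intervalIntegral.integral_eq_sub_of_hasDerivAt_of_le hab hF hd
      ((intervalIntegrable_iff_integrableOn_Ioc_of_le hab).2 hi)]

end RadialIntegrals

/-! ### The density of a coordinate and its total mass -/

/-- The density of the third Bloch coordinate. -/
noncomputable def axisDensity (z : ℝ) : ℝ :=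
  20 / 11 * (z ^ 4 + 7 * |z| ^ 3 + 17 * z ^ 2 + 7 * |z| + 1) * (1 - |z|) ^ 7

theorem axisDensity_nonneg {z : ℝ} (hz : z ∈ Set.Icc (-1 : ℝ) 1) : 0 ≤ axisDensity z := by
  have : 0 ≤ 1 - |z| := sub_nonneg.2 (abs_le.2 hz)
  unfold axisDensity
  positivity

theorem continuous_axisDensity : Continuous axisDensity := by
  unfold axisDensity
  fun_prop

theorem lintegral_axisDensity :
    ∫⁻ z in Set.Icc (-1 : ℝ) 1, ENNReal.ofReal (axisDensity z) = 1 := by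
  -- A primitive of the density in the variable `u = 1 - |z|`, with the quartic factor expanded in
  -- powers of `u`. Each half of `[-1, 1]` contributes `P 1 - P 0 = 1/2`.
  let P : ℝ → ℝ := fun u => 20 / 11 * (33 / 8 * u ^ 8 - 66 / 9 * u ^ 9 + 44 / 10 * u ^ 10
    - u ^ 11 + u ^ 12 / 12)
  have hP : ∀ u, HasDerivAt P
      (20 / 11 * (33 * u ^ 7 - 66 * u ^ 8 + 44 * u ^ 9 - 11 * u ^ 10 + u ^ 11)) u := by
    intro u
    have h := ((((((hasDerivAt_pow 8 u).const_mul (33 / 8 : ℝ)).sub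
      ((hasDerivAt_pow 9 u).const_mul (66 / 9 : ℝ))).add
      ((hasDerivAt_pow 10 u).const_mul (44 / 10 : ℝ))).sub (hasDerivAt_pow 11 u)).add
      ((hasDerivAt_pow 12 u).div_const 12)).const_mul (20 / 11 : ℝ)
    refine HasDerivAt.congr_deriv (f := P) h ?_
    norm_num
    ring
  have hc : Continuous P := by fun_prop
  have h1 : ∫⁻ z in Set.Ioo (-1 : ℝ) 0, ENNReal.ofReal (axisDensity z) =
      ENNReal.ofReal (P (1 + 0) - P (1 + -1)) := by
    refine lintegral_Ioo_eq_sub_of_hasDerivAt (F := fun z => P (1 + z)) (by norm_num)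
      (by fun_prop) (fun y hy => ?_)
      fun y hy => axisDensity_nonneg ⟨hy.1.le, hy.2.le.trans zero_le_one⟩
    refine ((hP (1 + y)).comp_const_add 1 y).congr_deriv ?_
    rw [axisDensity, abs_of_neg hy.2]
    ring
  have h2 : ∫⁻ z in Set.Ioo (0 : ℝ) 1, ENNReal.ofReal (axisDensity z) =
      ENNReal.ofReal (-P (1 - 1) - -P (1 - 0)) := by
    refine lintegral_Ioo_eq_sub_of_hasDerivAt (F := fun z => -P (1 - z)) (by norm_num)
      (by fun_prop) (fun y hy => ?_)
      fun y hy => axisDensity_nonneg ⟨by linarith [hy.1], hy.2.le⟩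
    refine ((hP (1 - y)).comp_const_sub 1 y).neg.congr_deriv ?_
    rw [axisDensity, abs_of_pos hy.1]
    ring
  have hs : (Set.Icc (-1 : ℝ) 1) = Set.Icc (-1 : ℝ) 0 ∪ Set.Ioc (0 : ℝ) 1 :=
    (Set.Icc_union_Ioc_eq_Icc (by norm_num) (by norm_num)).symm
  rw [hs, lintegral_union measurableSet_Ioc
    (Set.disjoint_left.2 fun x hx hx' => absurd hx.2 (not_le.2 hx'.1)),
    setLIntegral_congr Ioo_ae_eq_Icc.symm, setLIntegral_congr Ioo_ae_eq_Ioc.symm, h1, h2,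
    ← ENNReal.ofReal_add (by norm_num [P]) (by norm_num [P])]
  norm_num [P]

/-- The law of the third Bloch coordinate. -/
noncomputable def axisLaw : Measure ℝ :=
  (volume.restrict (Set.Icc (-1 : ℝ) 1)).withDensity fun z => ENNReal.ofReal (axisDensity z)

theorem lintegral_axisLaw {g : ℝ → ENNReal} (hg : Measurable g) :
    ∫⁻ z, g z ∂axisLaw =
      ∫⁻ z, (Set.Icc (-1 : ℝ) 1).indicator (fun z => ENNReal.ofReal (axisDensity z)) z * g z := by
  rw [axisLaw, lintegral_withDensity_eq_lintegral_mul _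
    (continuous_axisDensity.measurable.ennreal_ofReal) hg,
    ← lintegral_indicator measurableSet_Icc]
  refine lintegral_congr fun z => ?_
  by_cases hz : z ∈ Set.Icc (-1 : ℝ) 1
  · simp only [Set.indicator_of_mem hz, Pi.mul_apply]
  · simp only [Set.indicator_of_notMem hz, zero_mul]

theorem axisLaw_univ : axisLaw Set.univ = 1 := by
  rw [axisLaw, withDensity_apply _ MeasurableSet.univ, setLIntegral_univ, lintegral_axisDensity]

/-! ### The radial density and its integrals over planes -/

/-- The density in `ℝ³` of the Bloch vector at a point of norm `r`. -/
noncomputable def radialDensity (r : ℝ) : ENNReal :=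
  (Set.Iic (1 : ℝ)).indicator (fun r => ENNReal.ofReal
    (10 / Real.pi * (1 - r) ^ 6 * (r ^ 3 + 6 * r ^ 2 + 12 * r + 2))) r

theorem measurable_radialDensity : Measurable radialDensity := by
  unfold radialDensity
  exact Measurable.indicator (by fun_prop) measurableSet_Iic

/-- In polar coordinates in the plane at height `z`, the substitution `r = √(z² + y²)` gives `r dr =
y dy`. The integral becomes that of `2πr` times the radial density over `|z| ≤ r ≤ 1`. -/
theorem lintegral_radialDensity_plane (z : ℝ) :
    ∫⁻ w : ℂ, radialDensity (√(z ^ 2 + ‖w‖ ^ 2)) =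
      (Set.Icc (-1 : ℝ) 1).indicator (fun z => ENNReal.ofReal (axisDensity z)) z := by
  by_cases hz : z ∈ Set.Icc (-1 : ℝ) 1
  swap
  · rw [Set.indicator_of_notMem hz, ← lintegral_zero (α := ℂ)]
    refine lintegral_congr fun w => Set.indicator_of_notMem (fun h => hz ?_) _
    exact abs_le.1 ((Real.abs_le_sqrt (le_add_of_nonneg_right (sq_nonneg _))).trans h)
  have hz1 : z ^ 2 ≤ 1 := (sq_le_one_iff_abs_le_one z).2 (abs_le.2 hz)
  rw [Set.indicator_of_mem hz, lintegral_fun_norm_complex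
    (f := fun y => radialDensity (√(z ^ 2 + y ^ 2)))
    (measurable_radialDensity.comp (by fun_prop))]
  -- The axis density on `r ≥ 0`; its derivative is `-2πr` times the radial density, and it vanishes
  -- at `r = 1`.
  let q : ℝ → ℝ := fun r => 20 / 11 * ((r ^ 4 + 7 * r ^ 3 + 17 * r ^ 2 + 7 * r + 1) * (1 - r) ^ 7)
  have hq : ∀ r, HasDerivAt q
      (-20 * r * (1 - r) ^ 6 * (r ^ 3 + 6 * r ^ 2 + 12 * r + 2)) r := by
    intro r
    have h := ((((((hasDerivAt_pow 4 r).add ((hasDerivAt_pow 3 r).const_mul 7)).add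
      ((hasDerivAt_pow 2 r).const_mul 17)).add ((hasDerivAt_id r).const_mul 7)).add_const 1).mul
      (((hasDerivAt_id r).const_sub 1).pow 7)).const_mul (20 / 11 : ℝ)
    refine HasDerivAt.congr_deriv (f := q) h ?_
    simp
    ring
  have hqc : Continuous q := by fun_prop
  have hsupp : ∀ y ∈ Set.Ioi (0 : ℝ), ENNReal.ofReal y * radialDensity (√(z ^ 2 + y ^ 2)) =
      (Set.Iic (√(1 - z ^ 2))).indicator (fun y => ENNReal.ofReal (10 / Real.pi * y *
        ((1 - √(z ^ 2 + y ^ 2)) ^ 6 * (√(z ^ 2 + y ^ 2) ^ 3 + 6 * √(z ^ 2 + y ^ 2) ^ 2 +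
          12 * √(z ^ 2 + y ^ 2) + 2)))) y := by
    intro y hy
    have hy : 0 < y := hy
    have hiff : √(z ^ 2 + y ^ 2) ∈ Set.Iic (1 : ℝ) ↔ y ∈ Set.Iic (√(1 - z ^ 2)) := by
      rw [Set.mem_Iic, Set.mem_Iic, Real.sqrt_le_iff, and_iff_right zero_le_one, one_pow,
        Real.le_sqrt' hy]
      constructor <;> intro h <;> linarith
    by_cases h : y ∈ Set.Iic (√(1 - z ^ 2))
    · rw [Set.indicator_of_mem h, radialDensity, Set.indicator_of_mem (hiff.2 h),
        ← ENNReal.ofReal_mul hy.le]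
      congr 1
      ring
    · rw [Set.indicator_of_notMem h, radialDensity, Set.indicator_of_notMem (hiff.not.2 h),
        mul_zero]
  rw [setLIntegral_congr_fun measurableSet_Ioi hsupp, lintegral_indicator measurableSet_Iic,
    Measure.restrict_restrict measurableSet_Iic, Set.inter_comm, Set.Ioi_inter_Iic,
    setLIntegral_congr Ioo_ae_eq_Ioc.symm,
    lintegral_Ioo_eq_sub_of_hasDerivAt (F := fun y => -q (√(z ^ 2 + y ^ 2)) / (2 * Real.pi))
      (Real.sqrt_nonneg _) (by fun_prop) (fun y hy => ?_) fun y hy => ?_]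
  · rw [← ENNReal.ofReal_mul (by positivity), Real.sq_sqrt (sub_nonneg.2 hz1)]
    congr 1
    have hpi := Real.pi_ne_zero
    simp only [add_sub_cancel, Real.sqrt_one, ne_eq, OfNat.ofNat_ne_zero, not_false_eq_true,
      zero_pow, add_zero, Real.sqrt_sq_eq_abs, axisDensity, q]
    field_simp
    rw [← sq_abs z, show z ^ 4 = |z| ^ 4 by rw [pow_abs, abs_of_nonneg (by positivity)]]
    ring
  · have hpos : 0 < z ^ 2 + y ^ 2 := by have := hy.1; positivity
    have hs : √(z ^ 2 + y ^ 2) ≠ 0 := (Real.sqrt_pos.2 hpos).ne'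
    have h := (((hq (√(z ^ 2 + y ^ 2))).comp y
      ((((hasDerivAt_pow 2 y).const_add (z ^ 2)).sqrt hpos.ne'))).neg).div_const (2 * Real.pi)
    refine HasDerivAt.congr_deriv (f := fun y => -q (√(z ^ 2 + y ^ 2)) / (2 * Real.pi)) h ?_
    have hpi := Real.pi_ne_zero
    field_simp
    norm_num
    ring
  · have := hy.1
    have := Real.pi_pos
    positivity

/-! ### Integration of the weight over the diagonal block with fixed trace -/

/-- `det(A)² det(1 - A)²` for a Hermitian `A` with `0 < A < 1`, in terms of `z = tr A - 1` and of
the squared radius `q` of the traceless part of `A`; zero outside that range. -/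
noncomputable def sliceWeight (z q : ℝ) : ENNReal :=
  if |z| < 1 ∧ q < ((1 - |z|) / 2) ^ 2 then
    ENNReal.ofReal ((((1 + z) / 2) ^ 2 - q) ^ 2 * (((1 - z) / 2) ^ 2 - q) ^ 2) else 0

theorem measurable_sliceWeight : Measurable fun p : ℝ × ℝ => sliceWeight p.1 p.2 := by
  unfold sliceWeight
  have h1 : MeasurableSet {p : ℝ × ℝ | |p.1| < 1} := measurableSet_lt (by fun_prop) (by fun_prop)
  have h2 : MeasurableSet {p : ℝ × ℝ | p.2 < ((1 - |p.1|) / 2) ^ 2} :=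
    measurableSet_lt (by fun_prop) (by fun_prop)
  exact Measurable.ite (h1.inter h2) (by fun_prop) measurable_const

/-- With `t = k - |c|²` and `k = ((1 - |z|)/2)² - x²`, the two determinants are `t` and `t + |z|` in
some order, because `((1 + |z|)/2)² - ((1 - |z|)/2)² = |z|`. Polar coordinates leave `π` times the
integral of `t²(t + |z|)²` over `0 < t < k`. -/
theorem lintegral_sliceWeight_plane {z x : ℝ} (hz : |z| < 1) :
    ∫⁻ c : ℂ, sliceWeight z (x ^ 2 + ‖c‖ ^ 2) =
      (Set.Ioo (-((1 - |z|) / 2)) ((1 - |z|) / 2)).indicator (fun x => ENNReal.ofReal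
        (Real.pi * ((((1 - |z|) / 2) ^ 2 - x ^ 2) ^ 5 / 5 +
          |z| * (((1 - |z|) / 2) ^ 2 - x ^ 2) ^ 4 / 2 +
          |z| ^ 2 * (((1 - |z|) / 2) ^ 2 - x ^ 2) ^ 3 / 3))) x := by
  have hm : 0 < (1 - |z|) / 2 := by linarith
  have hx_iff : x ∈ Set.Ioo (-((1 - |z|) / 2)) ((1 - |z|) / 2) ↔ x ^ 2 < ((1 - |z|) / 2) ^ 2 := by
    rw [Set.mem_Ioo, ← abs_lt, sq_lt_sq, abs_of_pos hm]
  by_cases hx : x ∈ Set.Ioo (-((1 - |z|) / 2)) ((1 - |z|) / 2)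
  swap
  · rw [Set.indicator_of_notMem hx, ← lintegral_zero (α := ℂ)]
    refine lintegral_congr fun c => if_neg fun h => hx (hx_iff.2 ?_)
    exact (le_add_of_nonneg_right (sq_nonneg _)).trans_lt h.2
  have hx' := hx_iff.1 hx
  rw [Set.indicator_of_mem hx, lintegral_fun_norm_complex
    (f := fun y => sliceWeight z (x ^ 2 + y ^ 2))
    (measurable_sliceWeight.comp (f := fun y : ℝ => (z, x ^ 2 + y ^ 2)) (by fun_prop))]
  set k := ((1 - |z|) / 2) ^ 2 - x ^ 2 with hk
  have hk0 : 0 < k := sub_pos.2 hx'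
  have hsupp : ∀ y ∈ Set.Ioi (0 : ℝ), ENNReal.ofReal y * sliceWeight z (x ^ 2 + y ^ 2) =
      (Set.Iio (√k)).indicator (fun y => ENNReal.ofReal (y * ((k - y ^ 2) ^ 2 *
        (k + |z| - y ^ 2) ^ 2))) y := by
    intro y hy
    have hy : 0 < y := hy
    have hiff : (|z| < 1 ∧ x ^ 2 + y ^ 2 < ((1 - |z|) / 2) ^ 2) ↔ y ∈ Set.Iio (√k) := by
      rw [Set.mem_Iio, Real.lt_sqrt hy.le]
      constructor
      · intro h
        linarith [h.2]
      · intro h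
        exact ⟨hz, by linarith⟩
    by_cases h : y ∈ Set.Iio (√k)
    · rw [Set.indicator_of_mem h, sliceWeight, if_pos (hiff.2 h), ← ENNReal.ofReal_mul hy.le, hk]
      congr 1
      rcases abs_cases z with ⟨h, -⟩ | ⟨h, -⟩ <;> rw [h] <;> ring
    · rw [Set.indicator_of_notMem h, sliceWeight, if_neg (hiff.not.2 h), mul_zero]
  let P : ℝ → ℝ := fun t => t ^ 5 / 5 + |z| * t ^ 4 / 2 + |z| ^ 2 * t ^ 3 / 3
  have hP : ∀ t, HasDerivAt P (t ^ 2 * (t + |z|) ^ 2) t := by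
    intro t
    have h := (((hasDerivAt_pow 5 t).div_const 5).add
      (((hasDerivAt_pow 4 t).const_mul |z|).div_const 2)).add
      (((hasDerivAt_pow 3 t).const_mul (|z| ^ 2)).div_const 3)
    refine HasDerivAt.congr_deriv (f := P) h ?_
    push_cast
    ring
  have hPc : Continuous P := by fun_prop
  rw [setLIntegral_congr_fun measurableSet_Ioi hsupp, lintegral_indicator measurableSet_Iio,
    Measure.restrict_restrict measurableSet_Iio, Set.inter_comm, Set.Ioi_inter_Iio,
    lintegral_Ioo_eq_sub_of_hasDerivAt (F := fun y => -P (k - y ^ 2) / 2)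
      (Real.sqrt_nonneg _) (by fun_prop) (fun y hy => ?_) fun y hy => ?_]
  · rw [← ENNReal.ofReal_mul (by positivity), Real.sq_sqrt hk0.le]
    congr 1
    simp only [P]
    ring
  · have h := (((hP (k - y ^ 2)).comp y ((hasDerivAt_pow 2 y).const_sub k)).neg).div_const 2
    refine HasDerivAt.congr_deriv (f := fun y => -P (k - y ^ 2) / 2) h ?_
    norm_num
    ring
  · have := hy.1
    positivity

theorem lintegral_sliceWeight (z : ℝ) :
    ∫⁻ x : ℝ, ∫⁻ c : ℂ, sliceWeight z (x ^ 2 + ‖c‖ ^ 2) =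
      ENNReal.ofReal (Real.pi / 25200) *
        (Set.Icc (-1 : ℝ) 1).indicator (fun z => ENNReal.ofReal (axisDensity z)) z := by
  by_cases hz : |z| < 1
  swap
  · have h0 : ∀ q, sliceWeight z q = 0 := fun q => if_neg fun h => hz h.1
    simp only [h0, lintegral_zero]
    by_cases hz' : z ∈ Set.Icc (-1 : ℝ) 1
    -- At the endpoints the slice is empty and the density vanishes through its factor `(1 -
    -- |z|)^7`.
    · have h1 : |z| = 1 := le_antisymm (abs_le.2 hz') (not_lt.1 hz)
      simp [axisDensity, h1]
    · simp [Set.indicator_of_notMem hz']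
  have hm : 0 < (1 - |z|) / 2 := by linarith
  rw [lintegral_congr fun x => lintegral_sliceWeight_plane (x := x) hz,
    lintegral_indicator measurableSet_Ioo,
    Set.indicator_of_mem (show z ∈ Set.Icc (-1 : ℝ) 1 from abs_le.1 hz.le)]
  generalize hmm : (1 - |z|) / 2 = m at hm
  -- A primitive in `x`, with the fifth, fourth and third powers of `m² - x²` expanded.
  let Q : ℝ → ℝ := fun x => Real.pi *
    ((m ^ 10 * x - 5 * m ^ 8 * (x ^ 3 / 3) + 10 * m ^ 6 * (x ^ 5 / 5) - 10 * m ^ 4 * (x ^ 7 / 7)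
      + 5 * m ^ 2 * (x ^ 9 / 9) - x ^ 11 / 11) / 5 +
    |z| * (m ^ 8 * x - 4 * m ^ 6 * (x ^ 3 / 3) + 6 * m ^ 4 * (x ^ 5 / 5) - 4 * m ^ 2 * (x ^ 7 / 7)
      + x ^ 9 / 9) / 2 +
    |z| ^ 2 * (m ^ 6 * x - 3 * m ^ 4 * (x ^ 3 / 3) + 3 * m ^ 2 * (x ^ 5 / 5) - x ^ 7 / 7) / 3)
  have hpow : ∀ (n : ℕ) (x : ℝ), HasDerivAt (fun x : ℝ => x ^ (n + 1) / (n + 1 : ℝ)) (x ^ n) x := by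
    intro n x
    refine ((hasDerivAt_pow (n + 1) x).div_const _).congr_deriv ?_
    have : (n + 1 : ℝ) ≠ 0 := by positivity
    push_cast
    field_simp
  rw [lintegral_Ioo_eq_sub_of_hasDerivAt (F := Q) (by linarith) (by fun_prop) (fun x _ => ?_)
    fun x hx => ?_]
  · rw [← ENNReal.ofReal_mul (by positivity)]
    congr 1
    rw [axisDensity, ← sq_abs z, show z ^ 4 = |z| ^ 4 by rw [pow_abs, abs_of_nonneg (by positivity)]]
    -- Eliminating `|z|` leaves a polynomial identity in `m`; it fixes the constant `π/25200`.
    have hz' : |z| = 1 - 2 * m := by linarith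
    simp only [Q, hz']
    ring
  · have h3 := hpow 2 x
    have h5 := hpow 4 x
    have h7 := hpow 6 x
    have h9 := hpow 8 x
    have h11 := hpow 10 x
    norm_num at h3 h5 h7 h9 h11
    have h1 := hasDerivAt_id x
    have h := ((((((((((h1.const_mul (m ^ 10)).sub (h3.const_mul (5 * m ^ 8))).add
      (h5.const_mul (10 * m ^ 6))).sub (h7.const_mul (10 * m ^ 4))).add
      (h9.const_mul (5 * m ^ 2))).sub h11).div_const 5)).add
      ((((((h1.const_mul (m ^ 8)).sub (h3.const_mul (4 * m ^ 6))).add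
      (h5.const_mul (6 * m ^ 4))).sub (h7.const_mul (4 * m ^ 2))).add h9).const_mul
        |z| |>.div_const 2)).add
      ((((((h1.const_mul (m ^ 6)).sub (h3.const_mul (3 * m ^ 4))).add
      (h5.const_mul (3 * m ^ 2))).sub h7).const_mul (|z| ^ 2)).div_const 3)).const_mul Real.pi
    refine HasDerivAt.congr_deriv (f := Q) h ?_
    ring
  · have h0 : 0 ≤ m ^ 2 - x ^ 2 := by
      rw [sub_nonneg, sq_le_sq, abs_of_pos hm]
      exact abs_le.2 ⟨hx.1.le, hx.2.le⟩
    have := Real.pi_pos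
    positivity

/-! ### Complete positivity and the Choi matrix -/

/-- The upper left block of the Choi matrix sorted by output indices. -/
noncomputable def diagBlock (a f : ℝ) (c : ℂ) : M2 := !![(a : ℂ), c; star c, (f : ℂ)]

/-- The upper right block of the Choi matrix sorted by output indices. -/
noncomputable def offBlock (q : ℂ × ℂ × ℂ × ℂ) : M2 := !![q.1, q.2.1; star q.2.2.1, q.2.2.2]

/-- The Choi matrix sorted by output indices. -/
noncomputable def outputChoi (a f : ℝ) (c : ℂ) (q : ℂ × ℂ × ℂ × ℂ) :
    Matrix (Fin 2 ⊕ Fin 2) (Fin 2 ⊕ Fin 2) ℂ :=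
  Matrix.fromBlocks (diagBlock a f c) (offBlock q) (offBlock q).conjTranspose
    (1 - diagBlock a f c)

/-- The position of input index `i` and output index `k` in the sorted Choi matrix. -/
def outputIndex (k i : Fin 2) : Fin 2 ⊕ Fin 2 := ![Sum.inl i, Sum.inr i] k

theorem outputIndex_surjective (s : Fin 2 ⊕ Fin 2) : ∃ k i, outputIndex k i = s := by
  rcases s with i | i
  exacts [⟨0, i, rfl⟩, ⟨1, i, rfl⟩]

theorem outputChoi_outputIndex (a f : ℝ) (b c d e g : ℂ) (i j k l : Fin 2) :
    outputChoi a f c (b, d, e, g) (outputIndex k i) (outputIndex l j) =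
      choiBlocks (a, f, b, c, d, e, g) i j k l := by
  fin_cases i <;> fin_cases j <;> fin_cases k <;> fin_cases l <;>
    simp [outputChoi, outputIndex, choiBlocks, diagBlock, offBlock]

theorem ofParam_tracePreserving (p : Param) (X : M2) : (ofParam p X).trace = X.trace := by
  obtain ⟨a, f, b, c, d, e, g⟩ := p
  simp [ofParam, choiMap, choiBlocks, Matrix.trace_fin_two, Fin.sum_univ_two]
  ring

theorem ofParam_single (p : Param) (i j : Fin 2) :
    ofParam p (Matrix.single i j 1) = choiBlocks p i j := by
  simp only [ofParam, choiMap, LinearMap.coe_mk, AddHom.coe_mk]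
  fin_cases i <;> fin_cases j <;> simp [Fin.sum_univ_two, Matrix.single_apply]

theorem exists_eq_star_mul_self {A : Type*} [NonUnitalCStarAlgebra A] [PartialOrder A]
    [StarOrderedRing A] {x : A} (hx : 0 ≤ x) : ∃ y, x = star y * y :=
  CStarAlgebra.nonneg_iff_eq_star_mul_self.1 hx

/-- One half of Choi's theorem: the block matrix of matrix units is positive, so its image under the
second amplification is positive. Flattening the blocks gives the Choi matrix. -/
theorem posSemidef_of_isQubitChannel {a f : ℝ} {b c d e g : ℂ}
    (h : IsQubitChannel (ofParam (a, f, b, c, d, e, g))) :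
    (outputChoi a f c (b, d, e, g)).PosSemidef := by
  obtain ⟨Ψ, hΨ⟩ := h.completelyPositive
  -- Only row `0` is nonzero, with entries `E₀ⱼ`. Since `Eᵢ₀ E₀ⱼ = Eᵢⱼ`, `star Z * Z` is the block
  -- matrix of matrix units.
  let Z : CStarMatrix (Fin 2) (Fin 2) (CStarMatrix (Fin 2) (Fin 2) ℂ) :=
    CStarMatrix.ofMatrix (Matrix.of fun i j =>
      if i = 0 then CStarMatrix.ofMatrix (Matrix.single 0 j 1) else 0)
  have hZ : ∀ i j, (star Z * Z) i j = CStarMatrix.ofMatrix (Matrix.single i j (1 : ℂ)) := by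
    intro i j
    have h0 : (star Z * Z) i j = star (Z 0 i) * Z 0 j + star (Z 1 i) * Z 1 j := by
      rw [CStarMatrix.mul_apply, Fin.sum_univ_two]
      rfl
    have h1 : Z 1 j = 0 := rfl
    have h2 : star (Z 0 i) * Z 0 j = CStarMatrix.ofMatrix
        ((Matrix.single 0 i (1 : ℂ)).conjTranspose * Matrix.single 0 j 1) := rfl
    rw [h0, h1, mul_zero, add_zero, h2, Matrix.conjTranspose_single, star_one,
      Matrix.single_mul_single_same, one_mul]
  have hpos : 0 ≤ (star Z * Z).map Ψ :=
    CompletelyPositiveMapClass.map_cstarMatrix_nonneg' Ψ 2 _ (star_mul_self_nonneg Z)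
  obtain ⟨W, hW⟩ := exists_eq_star_mul_self hpos
  have hC : ∀ i j k l, choiBlocks (a, f, b, c, d, e, g) i j k l =
      ∑ m, ∑ n, star (W m i n k) * W m j n l := by
    intro i j k l
    have h1 : ((star Z * Z).map Ψ) i j =
        CStarMatrix.ofMatrix (choiBlocks (a, f, b, c, d, e, g) i j) := by
      rw [CStarMatrix.map_apply, hZ, hΨ, ofParam_single]
    have h2 : ((star Z * Z).map Ψ) i j k l = choiBlocks (a, f, b, c, d, e, g) i j k l := by
      rw [h1]
      rfl
    rw [← h2, hW, CStarMatrix.mul_apply, Fin.sum_univ_two, Fin.sum_univ_two]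
    have h3 : ∀ m, ((star W) i m * W m j) k l = ∑ n, star (W m i n k) * W m j n l := fun m =>
      CStarMatrix.mul_apply
    rw [← h3, ← h3]
    rfl
  -- The blocks of `W` flattened, so that the Choi matrix is the Gram matrix of the columns of `M`.
  let M : Matrix (Fin 2 × Fin 2) (Fin 2 ⊕ Fin 2) ℂ := Matrix.of fun mn =>
    Sum.elim (fun i => W mn.1 i mn.2 0) (fun i => W mn.1 i mn.2 1)
  have hM : ∀ mn k i, M mn (outputIndex k i) = W mn.1 i mn.2 k := by
    intro mn k i
    fin_cases k <;> rfl
  have : outputChoi a f c (b, d, e, g) = M.conjTranspose * M := by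
    ext s t
    obtain ⟨k, i, rfl⟩ := outputIndex_surjective s
    obtain ⟨l, j, rfl⟩ := outputIndex_surjective t
    rw [outputChoi_outputIndex, hC, Matrix.mul_apply, Fintype.sum_prod_type]
    simp only [Matrix.conjTranspose_apply, hM]
  rw [this]
  exact Matrix.posSemidef_conjTranspose_mul_self M

/-- The converse half of Choi's theorem: a factorization `M* M` of the Choi matrix gives a Kraus
form `X ↦ ∑ Vₘ* X Vₘ`, with one Kraus operator for each row of `M`. -/
theorem isQubitChannel_of_posSemidef {a f : ℝ} {b c d e g : ℂ}
    (h : (outputChoi a f c (b, d, e, g)).PosSemidef) :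
    IsQubitChannel (ofParam (a, f, b, c, d, e, g)) := by
  refine ⟨?_, ofParam_tracePreserving _⟩
  obtain ⟨M, hM⟩ : ∃ M : Matrix (Fin 2 ⊕ Fin 2) (Fin 2 ⊕ Fin 2) ℂ,
      outputChoi a f c (b, d, e, g) = M.conjTranspose * M := by
    open scoped MatrixOrder Matrix.Norms.L2Operator in
    exact CStarAlgebra.nonneg_iff_eq_star_mul_self.1 h.nonneg
  let V : Fin 2 ⊕ Fin 2 → M2 := fun m => Matrix.of fun j l => M m (outputIndex l j)
  have hkraus : ∀ X : M2, ofParam (a, f, b, c, d, e, g) X =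
      ∑ m, (V m).conjTranspose * X * V m := by
    intro X
    ext k l
    have h1 : ∀ i j, choiBlocks (a, f, b, c, d, e, g) i j k l =
        ∑ m, star (V m i k) * V m j l := by
      intro i j
      rw [← outputChoi_outputIndex, hM, Matrix.mul_apply]
      rfl
    simp only [ofParam, choiMap, LinearMap.coe_mk, AddHom.coe_mk, Matrix.sum_apply,
      Matrix.add_apply, Matrix.smul_apply, h1, Matrix.mul_apply, Matrix.conjTranspose_apply,
      Fin.sum_univ_two, smul_eq_mul, Finset.mul_sum, ← Finset.sum_add_distrib]
    refine Finset.sum_congr rfl fun m _ => ?_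
    ring
  refine ⟨{ toFun := fun X => CStarMatrix.ofMatrix
              (ofParam (a, f, b, c, d, e, g) (CStarMatrix.ofMatrix.symm X))
            map_add' := fun X Y => (ofParam (a, f, b, c, d, e, g)).map_add _ _
            map_smul' := fun t X => (ofParam (a, f, b, c, d, e, g)).map_smul _ _
            map_cstarMatrix_nonneg' := ?_ }, fun X => rfl⟩
  intro n Y hY
  obtain ⟨Z, rfl⟩ := exists_eq_star_mul_self hY
  -- Multiplying every entry of `Z` on the right by `Vₘ` exhibits the image of `star Z * Z` as the
  -- sum of the positive elements `star (U m) * U m`.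
  let U : Fin 2 ⊕ Fin 2 → CStarMatrix (Fin n) (Fin n) (CStarMatrix (Fin 2) (Fin 2) ℂ) := fun m =>
    CStarMatrix.ofMatrix (Matrix.of fun i j => Z i j * CStarMatrix.ofMatrix (V m))
  suffices hs : ∀ i j, CStarMatrix.ofMatrix (ofParam (a, f, b, c, d, e, g)
      (CStarMatrix.ofMatrix.symm ((star Z * Z) i j))) = ∑ m, (star (U m) * U m) i j by
    have hsum : ∀ (s : Finset (Fin 2 ⊕ Fin 2)) i j,
        (∑ m ∈ s, star (U m) * U m) i j = ∑ m ∈ s, (star (U m) * U m) i j := by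
      intro s i j
      induction s using Finset.induction_on with
      | empty => rfl
      | insert x s hx ih => rw [Finset.sum_insert hx, Finset.sum_insert hx, ← ih]; rfl
    refine le_of_le_of_eq (Finset.sum_nonneg fun m (_ : m ∈ Finset.univ) =>
      star_mul_self_nonneg (U m)) ?_
    refine CStarMatrix.ext fun i j => ?_
    rw [hsum, ← hs]
    rfl
  intro i j
  have hY : CStarMatrix.ofMatrix (ofParam (a, f, b, c, d, e, g)
      (CStarMatrix.ofMatrix.symm ((star Z * Z) i j))) =
      ∑ m, star (CStarMatrix.ofMatrix (V m)) * ((star Z * Z) i j) * CStarMatrix.ofMatrix (V m) := by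
    rw [hkraus]
    rfl
  rw [hY]
  refine Finset.sum_congr rfl fun m _ => ?_
  rw [CStarMatrix.mul_apply, CStarMatrix.mul_apply, Finset.mul_sum, Finset.sum_mul]
  refine Finset.sum_congr rfl fun r _ => ?_
  have h1 : (star (U m)) i r = star (Z r i * CStarMatrix.ofMatrix (V m)) := rfl
  have h2 : U m r j = Z r j * CStarMatrix.ofMatrix (V m) := rfl
  have h3 : (star Z) i r = star (Z r i) := rfl
  rw [h1, h2, h3, star_mul]
  simp only [mul_assoc]

theorem mem_channels {a f : ℝ} {b c d e g : ℂ} :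
    (a, f, b, c, d, e, g) ∈ channels ↔ (outputChoi a f c (b, d, e, g)).PosSemidef :=
  ⟨posSemidef_of_isQubitChannel, isQubitChannel_of_posSemidef⟩

theorem isClosed_setOf_posSemidef {n : Type*} [Fintype n] :
    IsClosed {M : Matrix n n ℂ | M.PosSemidef} := by
  simp only [Matrix.posSemidef_iff_dotProduct_mulVec, Set.ofPred_and, Set.ofPred_forall]
  refine IsClosed.inter (isClosed_eq (by fun_prop) continuous_id) (isClosed_iInter fun x => ?_)
  exact isClosed_le continuous_const (by fun_prop)

theorem continuous_outputChoi :
    Continuous fun p : ℝ × ℝ × ℂ × (ℂ × ℂ × ℂ × ℂ) => outputChoi p.1 p.2.1 p.2.2.1 p.2.2.2 := by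
  unfold outputChoi diagBlock offBlock
  refine Continuous.matrix_fromBlocks ?_ ?_ ?_ ?_
  all_goals refine continuous_matrix fun i j => ?_
  all_goals
    fin_cases i <;> fin_cases j <;>
      simp <;> fun_prop

theorem measurableSet_channels : MeasurableSet channels := by
  have h : channels = (fun p : Param => outputChoi p.1 p.2.1 p.2.2.2.1
      (p.2.2.1, p.2.2.2.2.1, p.2.2.2.2.2.1, p.2.2.2.2.2.2)) ⁻¹' {M | M.PosSemidef} := by
    ext ⟨a, f, b, c, d, e, g⟩
    exact mem_channels
  rw [h]
  refine (isClosed_setOf_posSemidef.preimage ?_).measurableSet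
  exact continuous_outputChoi.comp (f := fun p : Param => (p.1, p.2.1, p.2.2.2.1,
      (p.2.2.1, p.2.2.2.2.1, p.2.2.2.2.2.1, p.2.2.2.2.2.2))) (by fun_prop)

/-! ### Volume of the slice over a fixed diagonal block -/

/-- `offBlock` as a real linear equivalence. -/
noncomputable def offBlockEquiv : (ℂ × ℂ × ℂ × ℂ) ≃ₗ[ℝ] M2 where
  toFun := offBlock
  invFun B := (B 0 0, B 0 1, star (B 1 0), B 1 1)
  map_add' p q := by
    ext i j
    fin_cases i <;> fin_cases j <;> simp [offBlock]
  map_smul' t q := by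
    ext i j
    fin_cases i <;> fin_cases j <;> simp [offBlock]
  left_inv q := by simp [offBlock]
  right_inv B := by
    ext i j
    fin_cases i <;> fin_cases j <;> simp [offBlock]

/-- In the basis of matrix units, `X ↦ L X R` has matrix `L ⊗ Rᵀ`. -/
theorem det_mulLeft_mulRight (L R : M2) :
    LinearMap.det (LinearMap.mulLeft ℂ L ∘ₗ LinearMap.mulRight ℂ R) = L.det ^ 2 * R.det ^ 2 := by
  rw [← LinearMap.det_toMatrix ((Matrix.stdBasis ℂ (Fin 2) (Fin 2)).reindex finProdFinEquiv)]
  have h : LinearMap.toMatrix ((Matrix.stdBasis ℂ (Fin 2) (Fin 2)).reindex finProdFinEquiv)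
      ((Matrix.stdBasis ℂ (Fin 2) (Fin 2)).reindex finProdFinEquiv)
      (LinearMap.mulLeft ℂ L ∘ₗ LinearMap.mulRight ℂ R) = 
      (Matrix.kroneckerMap (· * ·) L R.transpose).submatrix
        finProdFinEquiv.symm finProdFinEquiv.symm := by
    ext s t
    obtain ⟨⟨i, j⟩, rfl⟩ := finProdFinEquiv.surjective s
    obtain ⟨⟨k, l⟩, rfl⟩ := finProdFinEquiv.surjective t
    rw [LinearMap.toMatrix_apply, Module.Basis.reindex_apply, Equiv.symm_apply_apply,
      Module.Basis.repr_reindex_apply, Equiv.symm_apply_apply, Matrix.submatrix_apply,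
      Equiv.symm_apply_apply, Equiv.symm_apply_apply, Matrix.kroneckerMap_apply,
      Matrix.stdBasis_eq_single]
    change (L * ((Matrix.single k l 1 : M2) * R) : M2) i j = _
    fin_cases i <;> fin_cases j <;> fin_cases k <;> fin_cases l <;>
      simp [Matrix.mul_apply, Matrix.single_apply]
  rw [h, Matrix.det_submatrix_equiv_self, Matrix.det_kronecker, Matrix.det_transpose]
  simp

/-- The real linear map `B ↦ L B R` in coordinates. -/
noncomputable def conjOff (L R : M2) : (ℂ × ℂ × ℂ × ℂ) →ₗ[ℝ] (ℂ × ℂ × ℂ × ℂ) :=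
  offBlockEquiv.symm.toLinearMap ∘ₗ
    (LinearMap.mulLeft ℂ L ∘ₗ LinearMap.mulRight ℂ R).restrictScalars ℝ ∘ₗ
    offBlockEquiv.toLinearMap

theorem offBlock_conjOff (L R : M2) (q : ℂ × ℂ × ℂ × ℂ) :
    offBlock (conjOff L R q) = L * (offBlock q * R) :=
  offBlockEquiv.apply_symm_apply _

/-- The determinant over `ℝ` of a complex linear map is the squared modulus of its complex
determinant. The conjugated coordinate in `offBlock` does no harm, since passing to coordinates is a
conjugation of the map by a real linear equivalence. -/
theorem det_conjOff (L R : M2) :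
    LinearMap.det (conjOff L R) = Complex.normSq L.det ^ 2 * Complex.normSq R.det ^ 2 := by
  have h := LinearMap.det_conj
    ((LinearMap.mulLeft ℂ L ∘ₗ LinearMap.mulRight ℂ R).restrictScalars ℝ) offBlockEquiv.symm
  rw [LinearEquiv.symm_symm] at h
  rw [conjOff, h, LinearMap.det_restrictScalars, det_mulLeft_mulRight, Algebra.norm_complex_eq]
  simp

/-- The slice of the set of channels over a fixed diagonal block. -/
def slice (a f : ℝ) (c : ℂ) : Set (ℂ × ℂ × ℂ × ℂ) := {q | (outputChoi a f c q).PosSemidef}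

/-- The coordinates of the contractions, that is the slice after normalization. -/
def contractions : Set (ℂ × ℂ × ℂ × ℂ) :=
  {q | (Matrix.fromBlocks 1 (offBlock q) (offBlock q).conjTranspose 1).PosSemidef}

theorem exists_isUnit_conjTranspose_mul_self {A : M2} (hA : A.PosDef) :
    ∃ L : M2, A = L.conjTranspose * L ∧ IsUnit L ∧ ((Complex.normSq L.det : ℝ) : ℂ) = A.det := by
  obtain ⟨L, hL⟩ : ∃ L : M2, A = L.conjTranspose * L := by
    open scoped MatrixOrder Matrix.Norms.L2Operator in
    exact CStarAlgebra.nonneg_iff_eq_star_mul_self.1 hA.posSemidef.nonneg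
  have hd : ((Complex.normSq L.det : ℝ) : ℂ) = A.det := by
    rw [hL, Matrix.det_mul, Matrix.det_conjTranspose, Complex.normSq_eq_conj_mul_self]
    rfl
  refine ⟨L, hL, (Matrix.isUnit_iff_isUnit_det _).2 (isUnit_iff_ne_zero.2 fun h => ?_), hd⟩
  rw [h, map_zero, Complex.ofReal_zero] at hd
  exact hA.det_pos.ne hd

/-- Congruence by the invertible matrix `diag(L, R)` preserves positive semidefiniteness and takes
the blocks `1, K, K*, 1` to `L*L, L*KR, R*K*L, R*R`. -/
theorem slice_eq_image {a f : ℝ} {c : ℂ} {L R : M2}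
    (hL : diagBlock a f c = L.conjTranspose * L) (hR : 1 - diagBlock a f c = R.conjTranspose * R)
    (hLu : IsUnit L) (hRu : IsUnit R) :
    slice a f c = conjOff L.conjTranspose R '' contractions := by
  have key : ∀ q, conjOff L.conjTranspose R q ∈ slice a f c ↔ q ∈ contractions := by
    intro q
    have hU : IsUnit (Matrix.fromBlocks L 0 0 R) := by
      rw [Matrix.isUnit_iff_isUnit_det, Matrix.det_fromBlocks_zero₂₁]
      exact ((Matrix.isUnit_iff_isUnit_det _).1 hLu).mul ((Matrix.isUnit_iff_isUnit_det _).1 hRu)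
    rw [contractions, Set.mem_ofPred_eq, ← Matrix.IsUnit.posSemidef_star_left_conjugate_iff hU,
      slice, Set.mem_ofPred_eq, outputChoi, hR, hL, offBlock_conjOff, Matrix.star_eq_conjTranspose,
      Matrix.fromBlocks_conjTranspose, Matrix.fromBlocks_multiply, Matrix.fromBlocks_multiply]
    simp [Matrix.mul_assoc]
  have hsurj : Function.Surjective (conjOff L.conjTranspose R) := by
    intro q
    have hL' := (Matrix.isUnit_iff_isUnit_det _).1 ((Matrix.isUnit_conjTranspose L).2 hLu)
    have hR' := (Matrix.isUnit_iff_isUnit_det _).1 hRu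
    refine ⟨conjOff L.conjTranspose⁻¹ R⁻¹ q, offBlockEquiv.injective ?_⟩
    change offBlock _ = offBlock _
    rw [offBlock_conjOff, offBlock_conjOff, Matrix.mul_assoc, Matrix.mul_assoc,
      Matrix.nonsing_inv_mul _ hR', Matrix.mul_one, Matrix.mul_nonsing_inv_cancel_left _ _ hL']
  ext q
  constructor
  · intro hq
    obtain ⟨q', rfl⟩ := hsurj q
    exact ⟨q', (key q').1 hq, rfl⟩
  · rintro ⟨q', hq', rfl⟩
    exact (key q').2 hq'

instance isAddHaarMeasure_volume_prod {E F : Type*} [NormedAddCommGroup E] [NormedAddCommGroup F]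
    [MeasureSpace E] [MeasureSpace F] [BorelSpace E] [BorelSpace F]
    [SFinite (volume : Measure E)] [SFinite (volume : Measure F)]
    [(volume : Measure E).IsAddHaarMeasure] [(volume : Measure F).IsAddHaarMeasure] :
    (volume : Measure (E × F)).IsAddHaarMeasure :=
  Measure.prod.instIsAddHaarMeasure volume volume

instance : (volume : Measure (ℂ × ℂ × ℂ)).IsAddHaarMeasure := isAddHaarMeasure_volume_prod

instance : (volume : Measure (ℂ × ℂ × ℂ × ℂ)).IsAddHaarMeasure := isAddHaarMeasure_volume_prod

instance : (volume : Measure (ℂ × ℂ × ℂ × ℂ × ℂ)).IsAddHaarMeasure := isAddHaarMeasure_volume_prod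

instance : (volume : Measure (ℝ × ℂ × ℂ × ℂ × ℂ × ℂ)).IsAddHaarMeasure :=
  isAddHaarMeasure_volume_prod

instance : (volume : Measure Param).IsAddHaarMeasure := isAddHaarMeasure_volume_prod

theorem volume_slice {a f : ℝ} {c : ℂ} (hA : (diagBlock a f c).PosDef)
    (hA' : (1 - diagBlock a f c).PosDef) :
    volume (slice a f c) = ENNReal.ofReal
      ((a * f - ‖c‖ ^ 2) ^ 2 * ((1 - a) * (1 - f) - ‖c‖ ^ 2) ^ 2) * volume contractions := by
  obtain ⟨L, hL, hLu, hLd⟩ := exists_isUnit_conjTranspose_mul_self hA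
  obtain ⟨R, hR, hRu, hRd⟩ := exists_isUnit_conjTranspose_mul_self hA'
  have h1 : Complex.normSq L.det = a * f - ‖c‖ ^ 2 := by
    rw [← Complex.ofReal_inj, hLd, ← Complex.normSq_eq_norm_sq]
    simp [diagBlock, Matrix.det_fin_two, Complex.normSq_eq_conj_mul_self, mul_comm]
  have h2 : Complex.normSq R.det = (1 - a) * (1 - f) - ‖c‖ ^ 2 := by
    rw [← Complex.ofReal_inj, hRd, ← Complex.normSq_eq_norm_sq]
    simp [diagBlock, Matrix.det_fin_two, Complex.normSq_eq_conj_mul_self, mul_comm]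
  rw [slice_eq_image hL hR hLu hRu, Measure.addHaar_image_linearMap, det_conjOff,
    Matrix.det_conjTranspose, h2, ← h1]
  congr 2
  rw [abs_of_nonneg (by positivity)]
  simp

theorem contractions_subset :
    contractions ⊆ Metric.closedBall 0 1 := by
  intro q hq
  have hij : ∀ i j, ‖offBlock q i j‖ ≤ 1 := by
    intro i j
    -- The principal minor on one index from each half is `1 - |Kᵢⱼ|²`.
    have h := (Matrix.PosSemidef.submatrix hq ![Sum.inl i, Sum.inr j]).det_nonneg
    have h' : (0 : ℂ) ≤ ((1 - ‖offBlock q i j‖ ^ 2 : ℝ) : ℂ) := by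
      rw [← Complex.normSq_eq_norm_sq]
      rw [Matrix.det_fin_two] at h
      simpa [Complex.normSq_eq_conj_mul_self, mul_comm] using h
    have h1 := Complex.zero_le_real.1 h'
    exact abs_le_one_iff_mul_self_le_one.2 (by nlinarith) |>.trans' (le_abs_self _)
  rw [mem_closedBall_zero_iff]
  simp only [Prod.norm_def, sup_le_iff]
  refine ⟨hij 0 0, hij 0 1, ?_, hij 1 1⟩
  simpa [offBlock] using hij 1 0

theorem ball_subset_contractions :
    Metric.ball 0 (1 / 2) ⊆ contractions := by
  intro q hq
  simp only [mem_ball_zero_iff, Prod.norm_def, sup_lt_iff] at hq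
  have hij : ∀ i j, ‖offBlock q i j‖ ≤ 1 / 2 := by
    obtain ⟨h1, h2, h3, h4⟩ := hq
    intro i j
    fin_cases i <;> fin_cases j <;> simp [offBlock] <;> linarith
  rw [contractions, Set.mem_ofPred_eq, Matrix.posSemidef_iff_dotProduct_mulVec]
  refine ⟨?_, fun x => ?_⟩
  · rw [Matrix.IsHermitian, Matrix.fromBlocks_conjTranspose]
    simp
  -- Each `|xᵢ|²` is shared equally between the two pairs `(i, j)` that contain it, so the form
  -- splits into four summands. Each of them is nonnegative once the entry has modulus at most
  -- `1/2`.
  have hx : dotProduct (star x) (Matrix.mulVec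
      (Matrix.fromBlocks 1 (offBlock q) (offBlock q).conjTranspose 1) x) =
      ((∑ i, ∑ j, (‖x (Sum.inl i)‖ ^ 2 / 2 + ‖x (Sum.inr j)‖ ^ 2 / 2 +
        2 * (star (x (Sum.inl i)) * offBlock q i j * x (Sum.inr j)).re) : ℝ) : ℂ) := by
    simp only [Complex.ofReal_sum, Complex.ofReal_add, Complex.ofReal_mul, Complex.re_eq_add_conj,
      Complex.ofReal_div, Complex.ofReal_pow, ← Complex.conj_mul', Complex.ofReal_ofNat]
    simp [dotProduct, Matrix.mulVec, Fin.sum_univ_two, Matrix.one_apply]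
    ring
  rw [hx, Complex.zero_le_real]
  refine Finset.sum_nonneg fun i _ => Finset.sum_nonneg fun j _ => ?_
  have h1 := (abs_le.1 (Complex.abs_re_le_norm
    (star (x (Sum.inl i)) * offBlock q i j * x (Sum.inr j)))).1
  rw [norm_mul, norm_mul, norm_star] at h1
  have h2 : ‖x (Sum.inl i)‖ * ‖offBlock q i j‖ * ‖x (Sum.inr j)‖ ≤
      ‖x (Sum.inl i)‖ * (1 / 2) * ‖x (Sum.inr j)‖ := by
    gcongr
    exact hij i j
  nlinarith [sq_nonneg (‖x (Sum.inl i)‖ - ‖x (Sum.inr j)‖)]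

theorem volume_contractions_ne_zero : volume contractions ≠ 0 :=
  ((Metric.measure_ball_pos volume _ (by norm_num)).trans_le
    (measure_mono ball_subset_contractions)).ne'

theorem volume_contractions_ne_top : volume contractions ≠ ⊤ :=
  ((measure_mono contractions_subset).trans_lt
    (isCompact_closedBall _ _).measure_lt_top).ne

/-! ### Positivity of the diagonal blocks and the slice weight -/

theorem isHermitian_diagBlock (a f : ℝ) (c : ℂ) : (diagBlock a f c).IsHermitian := by
  ext i j
  fin_cases i <;> fin_cases j <;> simp [diagBlock]

theorem posDef_of_trace_pos_of_det_pos {A : M2} (hA : A.IsHermitian) (ht : 0 < A.trace)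
    (hd : 0 < A.det) : A.PosDef := by
  rw [hA.posDef_iff_eigenvalues_pos]
  rw [hA.trace_eq_sum_eigenvalues, Fin.sum_univ_two] at ht
  rw [hA.det_eq_prod_eigenvalues, Fin.prod_univ_two] at hd
  have ht' : 0 < hA.eigenvalues 0 + hA.eigenvalues 1 :=
    Complex.zero_lt_real.1 (by push_cast; exact ht)
  have hd' : 0 < hA.eigenvalues 0 * hA.eigenvalues 1 :=
    Complex.zero_lt_real.1 (by push_cast; exact hd)
  have h := (pos_and_pos_or_neg_and_neg_of_mul_pos hd').resolve_right (by rintro ⟨h1, h2⟩; linarith)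
  intro i
  fin_cases i
  exacts [h.1, h.2]

theorem det_diagBlock (a f : ℝ) (c : ℂ) :
    (diagBlock a f c).det = ((a * f - ‖c‖ ^ 2 : ℝ) : ℂ) := by
  rw [← Complex.normSq_eq_norm_sq]
  simp [diagBlock, Matrix.det_fin_two, Complex.normSq_eq_conj_mul_self, mul_comm]

theorem one_sub_diagBlock (a f : ℝ) (c : ℂ) :
    1 - diagBlock a f c = diagBlock (1 - a) (1 - f) (-c) := by
  ext i j
  fin_cases i <;> fin_cases j <;> simp [diagBlock]

theorem posDef_diagBlock {a f : ℝ} {c : ℂ} (ht : 0 < a + f) (hd : ‖c‖ ^ 2 < a * f) :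
    (diagBlock a f c).PosDef := by
  refine posDef_of_trace_pos_of_det_pos (isHermitian_diagBlock a f c) ?_ ?_
  · have : (diagBlock a f c).trace = ((a + f : ℝ) : ℂ) := by
      simp [diagBlock, Matrix.trace_fin_two]
    rw [this]
    exact Complex.zero_lt_real.2 ht
  · rw [det_diagBlock]
    exact Complex.zero_lt_real.2 (sub_pos.2 hd)

theorem nonneg_of_posSemidef_diagBlock {a f : ℝ} {c : ℂ} (h : (diagBlock a f c).PosSemidef) :
    0 ≤ a ∧ 0 ≤ f ∧ ‖c‖ ^ 2 ≤ a * f := by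
  refine ⟨Complex.zero_le_real.1 (h.diag_nonneg (i := 0)),
    Complex.zero_le_real.1 (h.diag_nonneg (i := 1)), ?_⟩
  have := h.det_nonneg
  rw [det_diagBlock] at this
  exact sub_nonneg.1 (Complex.zero_le_real.1 this)

theorem ae_normSq_ne (t : ℝ) : ∀ᵐ c : ℂ, ‖c‖ ^ 2 ≠ t := by
  refine measure_mono_null (fun c hc => ?_) (Measure.addHaar_sphere volume (0 : ℂ) (√t))
  have hc : ‖c‖ ^ 2 = t := not_not.1 hc
  rw [mem_sphere_zero_iff_norm, ← hc, Real.sqrt_sq (norm_nonneg c)]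

/-- Off the two circles on which `det A` or `det(1 - A)` vanishes, either both blocks are positive
definite and `volume_slice` applies, or the slice is empty. The circles are null. -/
theorem volume_slice_ae (a f : ℝ) : ∀ᵐ c : ℂ, volume (slice a f c) =
    sliceWeight (a + f - 1) (((a - f) / 2) ^ 2 + ‖c‖ ^ 2) * volume contractions := by
  filter_upwards [ae_normSq_ne (a * f), ae_normSq_ne ((1 - a) * (1 - f))] with c hc1 hc2
  -- `((1 - |z|)/2)²` is the smaller of `((1 + z)/2)²` and `((1 - z)/2)²`, so the bound on the
  -- radius says that both determinants are positive.
  have hiff : (|a + f - 1| < 1 ∧ ((a - f) / 2) ^ 2 + ‖c‖ ^ 2 < ((1 - |a + f - 1|) / 2) ^ 2) ↔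
      (0 < a + f ∧ a + f < 2) ∧ ‖c‖ ^ 2 < a * f ∧ ‖c‖ ^ 2 < (1 - a) * (1 - f) := by
    rw [abs_lt]
    refine and_congr ⟨fun h => ⟨by linarith, by linarith⟩, fun h => ⟨by linarith, by linarith⟩⟩ ?_
    rcases abs_cases (a + f - 1) with ⟨h, h'⟩ | ⟨h, h'⟩ <;> rw [h]
    · constructor
      · intro h
        constructor <;> nlinarith
      · intro h
        nlinarith
    · constructor
      · intro h
        constructor <;> nlinarith
      · intro h
        nlinarith
  by_cases h : (0 < a + f ∧ a + f < 2) ∧ ‖c‖ ^ 2 < a * f ∧ ‖c‖ ^ 2 < (1 - a) * (1 - f)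
  · rw [sliceWeight, if_pos (hiff.2 h), volume_slice (posDef_diagBlock h.1.1 h.2.1) ?_]
    · congr 3 <;> ring
    · rw [one_sub_diagBlock]
      exact posDef_diagBlock (by linarith [h.1.2]) (by rw [norm_neg]; exact h.2.2)
  · rw [sliceWeight, if_neg (hiff.not.2 h), zero_mul]
    suffices slice a f c = ∅ by rw [this, measure_empty]
    refine Set.eq_empty_of_forall_notMem fun q hq => h ?_
    have h1 : (diagBlock a f c).PosSemidef := Matrix.PosSemidef.submatrix hq Sum.inl
    have h2 : (1 - diagBlock a f c).PosSemidef := Matrix.PosSemidef.submatrix hq Sum.inr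
    rw [one_sub_diagBlock] at h2
    obtain ⟨ha, hf, hd⟩ := nonneg_of_posSemidef_diagBlock h1
    obtain ⟨ha', hf', hd'⟩ := nonneg_of_posSemidef_diagBlock h2
    rw [norm_neg] at hd'
    have hd := hd.lt_of_ne hc1
    have hd' := hd'.lt_of_ne hc2
    have h0 := sq_nonneg ‖c‖
    refine ⟨⟨?_, ?_⟩, hd, hd'⟩
    · exact add_pos_of_pos_of_nonneg (pos_of_mul_pos_left (h0.trans_lt hd) hf) hf
    · linarith [pos_of_mul_pos_left (h0.trans_lt hd') hf']

/-! ### Fubini and the law of the third Bloch coordinate -/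

theorem lintegral_prod_swap_left {X Y Z : Type*} [MeasureSpace X] [MeasureSpace Y] [MeasureSpace Z]
    [SFinite (volume : Measure X)] [SFinite (volume : Measure Y)] [SFinite (volume : Measure Z)]
    {F : X × Y × Z → ENNReal} (hF : Measurable F) :
    ∫⁻ p, F p = ∫⁻ y : Y, ∫⁻ q : X × Z, F (q.1, y, q.2) := by
  have h1 : ∀ x, ∫⁻ r : Y × Z, F (x, r) = ∫⁻ y, ∫⁻ w, F (x, y, w) := fun x =>
    lintegral_prod _ (hF.comp measurable_prodMk_left).aemeasurable
  have h2 : ∀ y, ∫⁻ q : X × Z, F (q.1, y, q.2) = ∫⁻ x, ∫⁻ w, F (x, y, w) := fun y =>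
    lintegral_prod _ (hF.comp (by fun_prop)).aemeasurable
  simp only [h2]
  rw [Measure.volume_eq_prod, lintegral_prod _ hF.aemeasurable]
  simp only [h1]
  refine lintegral_lintegral_swap (Measurable.aemeasurable ?_)
  exact Measurable.lintegral_prod_right' (f := fun r : (X × Y) × Z => F (r.1.1, r.1.2, r.2))
    (hF.comp (by fun_prop))

/-- The change of variables to `z = a + f - 1` and `x = (a - f)/2` has unit Jacobian. It is carried
out by two translations: in `f` with `a` fixed, then in `a` with `z` fixed, where `x = a - (1 +
z)/2`. -/
theorem lintegral_trace_diff {G : ℝ × ℝ → ENNReal} (hG : Measurable G) :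
    ∫⁻ a : ℝ, ∫⁻ f : ℝ, G (a + f - 1, (a - f) / 2) = ∫⁻ z : ℝ, ∫⁻ x : ℝ, G (z, x) := by
  calc ∫⁻ a : ℝ, ∫⁻ f : ℝ, G (a + f - 1, (a - f) / 2)
      = ∫⁻ a : ℝ, ∫⁻ z : ℝ, G (z, a - (1 + z) / 2) := by
        refine lintegral_congr fun a => ?_
        rw [← lintegral_add_right_eq_self _ (1 - a)]
        refine lintegral_congr fun z => ?_
        congr 2 <;> ring
    _ = ∫⁻ z : ℝ, ∫⁻ a : ℝ, G (z, a - (1 + z) / 2) :=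
        lintegral_lintegral_swap (Measurable.aemeasurable (hG.comp (by fun_prop)))
    _ = ∫⁻ z : ℝ, ∫⁻ x : ℝ, G (z, x) :=
        lintegral_congr fun z => lintegral_sub_right_eq_self (fun x => G (z, x)) _

theorem outBloch_eq (p : Param) : outBloch p = WithLp.toLp 2
    ![(p.2.2.1 + p.2.2.2.2.2.2).re, -(p.2.2.1 + p.2.2.2.2.2.2).im, p.1 + p.2.1 - 1] := by
  obtain ⟨a, f, b, c, d, e, g⟩ := p
  ext j
  fin_cases j <;>
    simp [outBloch, bloch, ofParam, choiMap, choiBlocks, maximallyMixed, pauli,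
      Matrix.trace_fin_two, Fin.sum_univ_two] <;> ring

theorem outBloch_two (p : Param) : outBloch p 2 = p.1 + p.2.1 - 1 := by
  rw [outBloch_eq]
  rfl

theorem measurable_outBloch : Measurable outBloch := by
  refine Continuous.measurable ?_
  simp only [funext outBloch_eq]
  refine (PiLp.continuous_toLp 2 _).comp (continuous_pi fun j => ?_)
  fin_cases j <;> simp <;> fun_prop

/-- Fubini with `a`, `f`, `c` outside and the off-diagonal block inside: the integrand depends on `a
+ f` only, so the inner integral is the volume of a slice. -/
theorem setLIntegral_channels {g : ℝ → ENNReal} (hg : Measurable g) :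
    ∫⁻ p in channels, g (p.1 + p.2.1 - 1) =
      ENNReal.ofReal (Real.pi / 25200) * volume contractions * ∫⁻ z, g z ∂axisLaw := by
  let χ : Param → ENNReal := channels.indicator 1
  have hχ : Measurable χ := measurable_one.indicator measurableSet_channels
  have hχ_apply : ∀ (a f : ℝ) (c : ℂ) (q : ℂ × ℂ × ℂ × ℂ),
      χ (a, f, q.1, c, q.2) = (slice a f c).indicator 1 q := by
    rintro a f c ⟨b, d, e, g⟩
    have : (a, f, b, c, d, e, g) ∈ channels ↔ (b, d, e, g) ∈ slice a f c := mem_channels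
    by_cases h : (b, d, e, g) ∈ slice a f c
    · rw [Set.indicator_of_mem h]
      exact Set.indicator_of_mem (this.2 h) _
    · rw [Set.indicator_of_notMem h]
      exact Set.indicator_of_notMem (this.not.2 h) _
  have hslice : ∀ a f c, MeasurableSet (slice a f c) := by
    intro a f c
    refine (isClosed_setOf_posSemidef.preimage ?_).measurableSet
    exact continuous_outputChoi.comp (f := fun q => (a, f, c, q)) (by fun_prop)
  calc ∫⁻ p in channels, g (p.1 + p.2.1 - 1)
      = ∫⁻ p : Param, g (p.1 + p.2.1 - 1) * χ p := by
        rw [← lintegral_indicator measurableSet_channels]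
        refine lintegral_congr fun p => ?_
        by_cases h : p ∈ channels
        · rw [Set.indicator_of_mem h, show χ p = 1 from Set.indicator_of_mem h _, mul_one]
        · rw [Set.indicator_of_notMem h, show χ p = 0 from Set.indicator_of_notMem h _, mul_zero]
    _ = ∫⁻ a : ℝ, ∫⁻ f : ℝ, ∫⁻ r : ℂ × ℂ × ℂ × ℂ × ℂ, g (a + f - 1) * χ (a, f, r) := by
        rw [Measure.volume_eq_prod, lintegral_prod _ (by fun_prop)]
        refine lintegral_congr fun a => ?_
        rw [Measure.volume_eq_prod, lintegral_prod _ (by fun_prop)]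
    _ = ∫⁻ a : ℝ, ∫⁻ f : ℝ, ∫⁻ c : ℂ, ∫⁻ q : ℂ × ℂ × ℂ × ℂ,
          g (a + f - 1) * χ (a, f, q.1, c, q.2) := by
        refine lintegral_congr fun a => lintegral_congr fun f => ?_
        exact lintegral_prod_swap_left (F := fun r => g (a + f - 1) * χ (a, f, r)) (by fun_prop)
    _ = ∫⁻ a : ℝ, ∫⁻ f : ℝ, ∫⁻ c : ℂ, g (a + f - 1) *
          (sliceWeight (a + f - 1) (((a - f) / 2) ^ 2 + ‖c‖ ^ 2) * volume contractions) := by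
        refine lintegral_congr fun a => lintegral_congr fun f => lintegral_congr_ae ?_
        filter_upwards [volume_slice_ae a f] with c hc
        simp only [hχ_apply]
        rw [lintegral_const_mul _ (measurable_one.indicator (hslice a f c)),
          lintegral_indicator_one (hslice a f c), hc]
    _ = ∫⁻ z : ℝ, ∫⁻ x : ℝ, ∫⁻ c : ℂ,
          g z * (sliceWeight z (x ^ 2 + ‖c‖ ^ 2) * volume contractions) := by
        refine lintegral_trace_diff (G := fun r => ∫⁻ c : ℂ,
          g r.1 * (sliceWeight r.1 (r.2 ^ 2 + ‖c‖ ^ 2) * volume contractions)) ?_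
        refine Measurable.lintegral_prod_right' (f := fun s : (ℝ × ℝ) × ℂ =>
          g s.1.1 * (sliceWeight s.1.1 (s.1.2 ^ 2 + ‖s.2‖ ^ 2) * volume contractions)) ?_
        refine Measurable.mul (by fun_prop) (Measurable.mul_const ?_ _)
        exact measurable_sliceWeight.comp (f := fun s : (ℝ × ℝ) × ℂ =>
          (s.1.1, s.1.2 ^ 2 + ‖s.2‖ ^ 2)) (by fun_prop)
    _ = ∫⁻ z : ℝ, g z * ((∫⁻ x : ℝ, ∫⁻ c : ℂ, sliceWeight z (x ^ 2 + ‖c‖ ^ 2)) *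
          volume contractions) := by
        refine lintegral_congr fun z => ?_
        have hm : Measurable fun s : ℝ × ℂ => sliceWeight z (s.1 ^ 2 + ‖s.2‖ ^ 2) :=
          measurable_sliceWeight.comp (f := fun s : ℝ × ℂ => (z, s.1 ^ 2 + ‖s.2‖ ^ 2))
            (by fun_prop)
        have hm1 : ∀ x, Measurable fun c : ℂ => sliceWeight z (x ^ 2 + ‖c‖ ^ 2) := fun x =>
          hm.comp measurable_prodMk_left
        have hm2 := Measurable.lintegral_prod_right' (ν := (volume : Measure ℂ)) hm
        rw [← lintegral_mul_const _ hm2, ← lintegral_const_mul _ (hm2.mul_const _)]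
        refine lintegral_congr fun x => ?_
        rw [← lintegral_mul_const _ (hm1 x), ← lintegral_const_mul _ ((hm1 x).mul_const _)]
    _ = _ := by
        rw [lintegral_axisLaw hg, ← lintegral_const_mul _ (by
          refine Measurable.mul ?_ hg
          exact continuous_axisDensity.measurable.ennreal_ofReal.indicator measurableSet_Icc)]
        refine lintegral_congr fun z => ?_
        rw [lintegral_sliceWeight]
        ring

theorem volume_channels :
    volume channels = ENNReal.ofReal (Real.pi / 25200) * volume contractions := by
  have h := setLIntegral_channels (g := 1) measurable_one
  simpa [axisLaw_univ] using h

theorem volume_channels_ne_zero : volume channels ≠ 0 := by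
  rw [volume_channels]
  refine mul_ne_zero ?_ volume_contractions_ne_zero
  rw [ne_eq, ENNReal.ofReal_eq_zero, not_le]
  positivity

theorem volume_channels_ne_top : volume channels ≠ ⊤ := by
  rw [volume_channels]
  exact ENNReal.mul_ne_top ENNReal.ofReal_ne_top volume_contractions_ne_top

instance isProbabilityMeasure_uniform : IsProbabilityMeasure uniform :=
  ProbabilityTheory.cond_isProbabilityMeasure_of_finite volume_channels_ne_zero
    volume_channels_ne_top

theorem map_outBloch_two : Measure.map (fun p => outBloch p 2) uniform = axisLaw := by
  refine Measure.ext_of_lintegral _ fun g hg => ?_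
  rw [lintegral_map hg (by simp only [outBloch_two]; fun_prop)]
  simp only [outBloch_two]
  rw [uniform, ProbabilityTheory.cond, lintegral_smul_measure, setLIntegral_channels hg,
    ← volume_channels, smul_eq_mul, ← mul_assoc,
    ENNReal.inv_mul_cancel volume_channels_ne_zero volume_channels_ne_top, one_mul]

/-! ### Half-turns of the output preserve the uniform distribution -/

/-- The coordinates read off from a Choi block matrix. -/
def blocksParam (C : Matrix (Fin 2) (Fin 2) M2) : Param :=
  ((C 0 0 0 0).re, (C 1 1 0 0).re, C 0 0 0 1, C 0 1 0 0, C 0 1 0 1, C 0 1 1 0, C 1 1 0 1)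

theorem blocksParam_choiBlocks (p : Param) : blocksParam (choiBlocks p) = p := by
  obtain ⟨a, f, b, c, d, e, g⟩ := p
  simp [blocksParam, choiBlocks]

theorem conjTranspose_choiBlocks (p : Param) (i j : Fin 2) :
    (choiBlocks p i j).conjTranspose = choiBlocks p j i := by
  obtain ⟨a, f, b, c, d, e, g⟩ := p
  ext k l
  fin_cases i <;> fin_cases j <;> fin_cases k <;> fin_cases l <;> simp [choiBlocks]

theorem trace_choiBlocks (p : Param) (i j : Fin 2) :
    (choiBlocks p i j).trace = if i = j then 1 else 0 := by
  obtain ⟨a, f, b, c, d, e, g⟩ := p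
  fin_cases i <;> fin_cases j <;> simp [choiBlocks, Matrix.trace_fin_two]

theorem choiBlocks_blocksParam {C : Matrix (Fin 2) (Fin 2) M2}
    (hC : ∀ i j, (C i j).conjTranspose = C j i)
    (hC' : ∀ i j, (C i j).trace = if i = j then 1 else 0) : choiBlocks (blocksParam C) = C := by
  have hs : ∀ i j k l, star (C i j l k) = C j i k l := fun i j k l =>
    congrFun (congrFun (hC i j) k) l
  have hr : ∀ i k, (((C i i k k).re : ℝ) : ℂ) = C i i k k := fun i k =>
    Complex.conj_eq_iff_re.1 (hs i i k k)
  have ht : ∀ i j, C i j 1 1 = (if i = j then 1 else 0) - C i j 0 0 := fun i j => by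
    rw [← hC' i j, Matrix.trace_fin_two, add_sub_cancel_left]
  ext i j k l
  fin_cases i <;> fin_cases j <;> fin_cases k <;> fin_cases l
  all_goals simp only [choiBlocks, blocksParam, hs, hr]
  all_goals simp [ht]

/-- Conjugation of the output of a channel by a matrix. -/
def rotate (U : M2) (p : Param) : Param :=
  blocksParam (Matrix.of fun i j => U * choiBlocks p i j * U)

theorem choiBlocks_rotate {U : M2} (hU : U.conjTranspose = U) (hU' : U * U = 1)
    (p : Param) (i j : Fin 2) :
    choiBlocks (rotate U p) i j = U * choiBlocks p i j * U := by
  rw [rotate, choiBlocks_blocksParam]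
  · rfl
  · intro i j
    simp only [Matrix.of_apply, Matrix.conjTranspose_mul, hU, conjTranspose_choiBlocks,
      Matrix.mul_assoc]
  · intro i j
    rw [Matrix.of_apply, Matrix.trace_mul_cycle, hU', Matrix.one_mul, trace_choiBlocks]

theorem rotate_rotate {U : M2} (hU : U.conjTranspose = U) (hU' : U * U = 1)
    (p : Param) : rotate U (rotate U p) = p := by
  rw [← blocksParam_choiBlocks (rotate U (rotate U p))]
  conv_rhs => rw [← blocksParam_choiBlocks p]
  congr 1
  refine Matrix.ext fun i j => ?_
  rw [choiBlocks_rotate hU hU', choiBlocks_rotate hU hU']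
  calc U * (U * choiBlocks p i j * U) * U = (U * U) * choiBlocks p i j * (U * U) := by
        simp only [Matrix.mul_assoc]
    _ = _ := by rw [hU', Matrix.one_mul, Matrix.mul_one]

theorem ofParam_rotate {U : M2} (hU : U.conjTranspose = U) (hU' : U * U = 1)
    (p : Param) (X : M2) : ofParam (rotate U p) X = U * ofParam p X * U := by
  simp only [ofParam, choiMap, LinearMap.coe_mk, AddHom.coe_mk, choiBlocks_rotate hU hU',
    Finset.mul_sum, Finset.sum_mul, Matrix.mul_smul, Matrix.smul_mul]

theorem rotate_mem_channels {U : M2} (hU : U.conjTranspose = U) (hU' : U * U = 1)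
    {p : Param} (hp : p ∈ channels) : rotate U p ∈ channels := by
  have key : ∀ p : Param, p ∈ channels ↔ (Matrix.of fun s t : Fin 2 × Fin 2 =>
      choiBlocks p s.2 t.2 s.1 t.1).PosSemidef := by
    rintro ⟨a, f, b, c, d, e, g⟩
    have he : (Matrix.of fun s t : Fin 2 × Fin 2 =>
        choiBlocks (a, f, b, c, d, e, g) s.2 t.2 s.1 t.1) =
        (outputChoi a f c (b, d, e, g)).submatrix (fun s => outputIndex s.1 s.2)
          (fun s => outputIndex s.1 s.2) := by
      ext s t
      exact (outputChoi_outputIndex a f b c d e g s.2 t.2 s.1 t.1).symm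
    rw [mem_channels, he]
    refine ⟨fun h => h.submatrix _, fun h => ?_⟩
    have h2 := h.submatrix (Sum.elim (fun i : Fin 2 => ((0 : Fin 2), i)) (fun i => (1, i)))
    rw [Matrix.submatrix_submatrix] at h2
    convert h2
    ext s t
    rcases s with s | s <;> rcases t with t | t <;> rfl
  rw [key] at hp ⊢
  -- On the Choi matrix indexed by (output, input), conjugation of the output is congruence by `U ⊗
  -- 1`.
  have h := hp.mul_mul_conjTranspose_same (Matrix.kroneckerMap (· * ·) U (1 : M2))
  convert h using 1
  ext ⟨k, i⟩ ⟨l, j⟩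
  have hs : ∀ a b, (starRingEnd ℂ) (U a b) = U b a := fun a b => congrFun (congrFun hU b) a
  rw [Matrix.of_apply, choiBlocks_rotate hU hU']
  fin_cases i <;> fin_cases j <;>
    simp [Matrix.mul_apply, Fintype.sum_prod_type, Fin.sum_univ_two, hs, Matrix.one_apply]

theorem rotate_preimage_channels {U : M2} (hU : U.conjTranspose = U) (hU' : U * U = 1) :
    rotate U ⁻¹' channels = channels := by
  ext p
  refine ⟨fun h => ?_, rotate_mem_channels hU hU'⟩
  rw [← rotate_rotate hU hU' p]
  exact rotate_mem_channels hU hU' h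

theorem blocksParam_add (C D : Matrix (Fin 2) (Fin 2) M2) :
    blocksParam (C + D) = blocksParam C + blocksParam D := by
  simp [blocksParam]

theorem blocksParam_smul (t : ℝ) (C : Matrix (Fin 2) (Fin 2) M2) :
    blocksParam (t • C) = t • blocksParam C := by
  simp [blocksParam]

theorem choiBlocks_add (p q : Param) (i j : Fin 2) : choiBlocks (p + q) i j =
    (choiBlocks p i j - choiBlocks 0 i j) + (choiBlocks q i j - choiBlocks 0 i j) +
      choiBlocks 0 i j := by
  obtain ⟨a, f, b, c, d, e, g⟩ := p
  obtain ⟨a', f', b', c', d', e', g'⟩ := q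
  ext k l
  fin_cases i <;> fin_cases j <;> fin_cases k <;> fin_cases l <;>
    simp [choiBlocks] <;> ring

theorem choiBlocks_smul (t : ℝ) (p : Param) (i j : Fin 2) : choiBlocks (t • p) i j =
    t • (choiBlocks p i j - choiBlocks 0 i j) + choiBlocks 0 i j := by
  obtain ⟨a, f, b, c, d, e, g⟩ := p
  ext k l
  fin_cases i <;> fin_cases j <;> fin_cases k <;> fin_cases l <;>
    simp [choiBlocks] <;> ring

/-- The linear part of `rotate`. -/
noncomputable def rotateLinear (U : M2) : Param →ₗ[ℝ] Param where
  toFun p := blocksParam (Matrix.of fun i j => U * (choiBlocks p i j - choiBlocks 0 i j) * U)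
  map_add' p q := by
    rw [← blocksParam_add]
    congr 1
    refine Matrix.ext fun i j => ?_
    simp only [Matrix.of_apply, Matrix.add_apply, choiBlocks_add, add_sub_cancel_right]
    rw [← Matrix.add_mul, ← Matrix.mul_add]
  map_smul' t p := by
    rw [RingHom.id_apply, ← blocksParam_smul]
    congr 1
    refine Matrix.ext fun i j => ?_
    simp only [Matrix.of_apply, Matrix.smul_apply, choiBlocks_smul, add_sub_cancel_right,
      Matrix.mul_smul, Matrix.smul_mul]

theorem rotate_eq (U : M2) (p : Param) : rotate U p = rotateLinear U p + rotate U 0 := by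
  simp [rotateLinear, rotate, blocksParam, Matrix.mul_sub, Matrix.sub_mul]

/-- `rotate U` is an affine involution, so its linear part squares to the identity and has
determinant `±1`. -/
theorem abs_det_rotateLinear {U : M2} (hU : U.conjTranspose = U) (hU' : U * U = 1) :
    |LinearMap.det (rotateLinear U)| = 1 := by
  have h : ∀ p, rotateLinear U (rotateLinear U p) +
      (rotateLinear U (rotate U 0) + rotate U 0) = p := by
    intro p
    conv_rhs => rw [← rotate_rotate hU hU' p, rotate_eq U (rotate U p), rotate_eq U p, map_add]
    abel
  -- At the origin the identity shows that the translation part of `rotate U` applied twice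
  -- vanishes.
  have h0 := h 0
  rw [map_zero, map_zero, zero_add] at h0
  have hsq : rotateLinear U ∘ₗ rotateLinear U = LinearMap.id := by
    refine LinearMap.ext fun p => ?_
    have := h p
    rwa [h0, add_zero] at this
  have hd := congrArg LinearMap.det hsq
  rw [LinearMap.det_comp, LinearMap.det_id] at hd
  exact (abs_eq zero_le_one).2 (mul_self_eq_one_iff.1 hd)

set_option synthInstance.maxSize 1000 in
theorem measurePreserving_rotate {U : M2} (hU : U.conjTranspose = U) (hU' : U * U = 1) :
    MeasurePreserving (rotate U) := by
  have hd := abs_det_rotateLinear hU hU'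
  have hd0 : LinearMap.det (rotateLinear U) ≠ 0 := by
    intro h
    simp [h] at hd
  have h1 : MeasurePreserving (rotateLinear U) := by
    refine ⟨(LinearMap.continuous_of_finiteDimensional _).measurable, ?_⟩
    rw [Measure.map_linearMap_addHaar_eq_smul_addHaar _ hd0, abs_inv, hd]
    simp
  have h2 := (measurePreserving_add_right (volume : Measure Param) (rotate U 0)).comp h1
  exact (funext (rotate_eq U) : rotate U = _) ▸ h2

theorem measurePreserving_rotate_uniform {U : M2} (hU : U.conjTranspose = U) (hU' : U * U = 1) :
    MeasurePreserving (rotate U) uniform uniform := by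
  have h := (measurePreserving_rotate hU hU').restrict_preimage measurableSet_channels
  rw [rotate_preimage_channels hU hU'] at h
  exact h.smul_measure _

/-- The observable `x · σ`. -/
noncomputable def pauliVec (x : EuclideanSpace ℝ (Fin 3)) : M2 := ∑ j, (x j : ℂ) • pauli j

theorem inner_bloch (ρ : M2) (u : EuclideanSpace ℝ (Fin 3)) :
    inner ℝ (bloch ρ) u = ((ρ * pauliVec u).trace).re := by
  simp [PiLp.inner_apply, bloch, pauliVec, Matrix.mul_add, Fin.sum_univ_three, Matrix.trace_add]

theorem pauliVec_eq (u : EuclideanSpace ℝ (Fin 3)) :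
    pauliVec u = !![(u 2 : ℂ), u 0 - u 1 * Complex.I; u 0 + u 1 * Complex.I, -(u 2 : ℂ)] := by
  ext i j
  fin_cases i <;> fin_cases j <;> simp [pauliVec, pauli, Fin.sum_univ_three]
  ring

/-- The half-turn about the bisector of `u` and the third axis exchanges the two. With `S = σ₃` and
`N = u · σ` it is implemented by `S + N`, normalized using `(S + N)² = 2 + 2u₃`. -/
theorem exists_halfTurn {u : EuclideanSpace ℝ (Fin 3)} (hu : ‖u‖ = 1) :
    ∃ U : M2, U.conjTranspose = U ∧ U * U = 1 ∧ U * pauliVec u * U = pauli 2 := by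
  have hu2 : u 0 ^ 2 + u 1 ^ 2 + u 2 ^ 2 = 1 := by
    have := EuclideanSpace.norm_sq_eq u
    rw [hu, Fin.sum_univ_three] at this
    simpa using this.symm
  by_cases h : u 2 = -1
  · have h0 : u 0 = 0 := by nlinarith [sq_nonneg (u 0), sq_nonneg (u 1)]
    have h1 : u 1 = 0 := by nlinarith [sq_nonneg (u 0), sq_nonneg (u 1)]
    -- Here `u` is opposite to the third axis and `S + N = 0`; the half-turn about the first axis
    -- serves instead.
    refine ⟨pauli 0, ?_, ?_, ?_⟩
    · ext i j
      fin_cases i <;> fin_cases j <;> simp [pauli]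
    · ext i j
      fin_cases i <;> fin_cases j <;> simp [pauli]
    · rw [pauliVec_eq, h, h0, h1]
      ext i j
      fin_cases i <;> fin_cases j <;> simp [pauli]
  have hpos : 0 < 2 + 2 * u 2 := by
    have : -1 ≤ u 2 := by nlinarith [sq_nonneg (u 0), sq_nonneg (u 1)]
    have := lt_of_le_of_ne this (Ne.symm h)
    linarith
  set s : ℝ := (√(2 + 2 * u 2))⁻¹ with hs
  have hss : (s * s * (2 + 2 * u 2) : ℂ) = 1 := by
    have : s * s * (2 + 2 * u 2) = 1 := by
      rw [hs, ← mul_inv, Real.mul_self_sqrt hpos.le, inv_mul_cancel₀ hpos.ne']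
    exact_mod_cast this
  have hSS : pauli 2 * pauli 2 = 1 := by
    ext i j
    fin_cases i <;> fin_cases j <;> simp [pauli]
  have hu2' : (u 0 ^ 2 + u 1 ^ 2 + u 2 ^ 2 : ℂ) = 1 := by 
    have h := congrArg (fun x : ℝ => (x : ℂ)) hu2
    push_cast at h
    exact h
  have hNN : pauliVec u * pauliVec u = 1 := by
    rw [pauliVec_eq]
    ext i j
    fin_cases i <;> fin_cases j <;> simp
    · linear_combination hu2' - (u 1 : ℂ) ^ 2 * Complex.I_sq
    · ring
    · ring
    · linear_combination hu2' - (u 1 : ℂ) ^ 2 * Complex.I_sq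
  have hSN : pauli 2 * pauliVec u + pauliVec u * pauli 2 = (2 * u 2 : ℂ) • (1 : M2) := by
    rw [pauliVec_eq]
    ext i j
    fin_cases i <;> fin_cases j <;> simp [pauli] <;> ring
  have hSh : (pauli 2).conjTranspose = pauli 2 := by
    ext i j
    fin_cases i <;> fin_cases j <;> simp [pauli]
  have hNh : (pauliVec u).conjTranspose = pauliVec u := by
    rw [pauliVec_eq]
    ext i j
    fin_cases i <;> fin_cases j <;> simp [sub_eq_add_neg]
  generalize pauliVec u = N at *
  generalize pauli 2 = S at *
  have hNS : N * S = (2 * u 2 : ℂ) • (1 : M2) - S * N := by rw [← hSN]; abel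
  refine ⟨(s : ℂ) • (S + N), ?_, ?_, ?_⟩
  · rw [Matrix.conjTranspose_smul, Matrix.conjTranspose_add, hSh, hNh]
    simp
  · have : (S + N) * (S + N) = (2 + 2 * u 2 : ℂ) • (1 : M2) := by
      rw [add_mul, mul_add, mul_add, hSS, hNN, hNS]
      module
    rw [Matrix.smul_mul, Matrix.mul_smul, this, smul_smul, smul_smul, hss, one_smul]
  · have : (S + N) * N * (S + N) = (2 + 2 * u 2 : ℂ) • S := by
      have h1 : S * N * S = (2 * u 2 : ℂ) • S - N := by
        rw [mul_assoc, hNS, mul_sub, ← mul_assoc, hSS, Matrix.mul_smul, mul_one, one_mul]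
      rw [add_mul, hNN, add_mul, mul_add, h1, mul_assoc, hNN, mul_one, one_mul]
      module
    rw [Matrix.smul_mul, Matrix.mul_smul, Matrix.smul_mul, this, smul_smul, smul_smul, hss,
      one_smul]

/-- By cyclicity of the trace, conjugating the output by `U` is the same as conjugating the
observable `u · σ`, which becomes `σ₃`. -/
theorem map_inner_outBloch {u : EuclideanSpace ℝ (Fin 3)} (hu : ‖u‖ = 1) :
    Measure.map (fun p => inner ℝ (outBloch p) u) uniform = axisLaw := by
  obtain ⟨U, hU, hU', hUu⟩ := exists_halfTurn hu
  have hmp := measurePreserving_rotate_uniform hU hU'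
  have hrot : ∀ p, inner ℝ (outBloch (rotate U p)) u = outBloch p 2 := by
    intro p
    rw [outBloch, ofParam_rotate hU hU', inner_bloch, Matrix.mul_assoc, Matrix.mul_assoc,
      Matrix.trace_mul_comm, Matrix.mul_assoc, hUu]
    rfl
  have hm : Measurable fun p => inner ℝ (outBloch p) u := measurable_outBloch.inner_const
  rw [← hmp.map_eq, Measure.map_map hm hmp.measurable, ← map_outBloch_two]
  congr 1
  exact funext hrot

/-! ### The spherically symmetric law and its identification by marginals -/

/-- The law of the Bloch vector, given by its radial density. -/
noncomputable def blochLaw : Measure (EuclideanSpace ℝ (Fin 3)) :=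
  volume.withDensity fun x => radialDensity ‖x‖

theorem measurable_radialDensity_norm :
    Measurable fun x : EuclideanSpace ℝ (Fin 3) => radialDensity ‖x‖ :=
  measurable_radialDensity.comp measurable_norm

theorem lintegral_blochLaw {g : EuclideanSpace ℝ (Fin 3) → ENNReal} (hg : Measurable g) :
    ∫⁻ x, g x ∂blochLaw = ∫⁻ x, radialDensity ‖x‖ * g x := by
  rw [blochLaw, lintegral_withDensity_eq_lintegral_mul _ measurable_radialDensity_norm hg]
  rfl

theorem map_blochLaw (T : EuclideanSpace ℝ (Fin 3) ≃ₗᵢ[ℝ] EuclideanSpace ℝ (Fin 3)) :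
    Measure.map T blochLaw = blochLaw := by
  have hT : Measurable T := T.continuous.measurable
  refine Measure.ext_of_lintegral _ fun g hg => ?_
  rw [lintegral_map hg hT, lintegral_blochLaw (g := fun x => g (T x)) (hg.comp hT),
    lintegral_blochLaw hg,
    ← T.measurePreserving.lintegral_comp (f := fun x => radialDensity ‖x‖ * g x)
      (measurable_radialDensity_norm.mul hg)]
  simp only [LinearIsometryEquiv.norm_map]

/-- Cylindrical coordinates `x ↦ (x₃, x₁ + i x₂)`. -/
noncomputable def cylinder (x : EuclideanSpace ℝ (Fin 3)) : ℝ × ℂ :=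
  (x 2, Complex.measurableEquivPi.symm ![x 0, x 1])

theorem measurePreserving_cylinder : MeasurePreserving cylinder := by
  have h1 := EuclideanSpace.volume_preserving_symm_measurableEquiv_toLp (Fin 3)
  have h2 := volume_preserving_piFinSuccAbove (fun _ : Fin 3 => ℝ) 2
  have h3 := (MeasurePreserving.id (volume : Measure ℝ)).prod
    Complex.volume_preserving_equiv_pi.symm
  have h := (h3.comp h2).comp h1
  refine (funext fun x => Prod.ext rfl (congrArg Complex.measurableEquivPi.symm ?_) :
    cylinder = _) ▸ h
  ext j
  fin_cases j <;> rfl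

theorem norm_eq_cylinder (x : EuclideanSpace ℝ (Fin 3)) :
    ‖x‖ = √((cylinder x).1 ^ 2 + ‖(cylinder x).2‖ ^ 2) := by
  rw [EuclideanSpace.norm_eq, Fin.sum_univ_three, ← Complex.normSq_eq_norm_sq]
  congr 1
  simp [cylinder, Complex.normSq_apply, Complex.measurableEquivPi]
  ring

theorem map_blochLaw_two :
    Measure.map (fun x : EuclideanSpace ℝ (Fin 3) => (x 2 : ℝ)) blochLaw = axisLaw := by
  have hm : Measurable fun x : EuclideanSpace ℝ (Fin 3) => x 2 := by fun_prop
  refine Measure.ext_of_lintegral _ fun g hg => ?_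
  have hG : Measurable fun r : ℝ × ℂ => radialDensity (√(r.1 ^ 2 + ‖r.2‖ ^ 2)) * g r.1 :=
    (measurable_radialDensity.comp (by fun_prop)).mul (by fun_prop)
  rw [lintegral_map hg hm, lintegral_blochLaw (g := fun x => g (x 2)) (hg.comp hm),
    lintegral_axisLaw hg]
  calc ∫⁻ x : EuclideanSpace ℝ (Fin 3), radialDensity ‖x‖ * g (x 2)
      = ∫⁻ x, (fun r : ℝ × ℂ => radialDensity (√(r.1 ^ 2 + ‖r.2‖ ^ 2)) * g r.1) (cylinder x) :=
        lintegral_congr fun x => by rw [norm_eq_cylinder]; rfl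
    _ = ∫⁻ z : ℝ, ∫⁻ w : ℂ, radialDensity (√(z ^ 2 + ‖w‖ ^ 2)) * g z := by
        rw [measurePreserving_cylinder.lintegral_comp hG, Measure.volume_eq_prod,
          lintegral_prod _ hG.aemeasurable]
    _ = _ := by
        refine lintegral_congr fun z => ?_
        have hr : Measurable fun w : ℂ => radialDensity (√(z ^ 2 + ‖w‖ ^ 2)) :=
          measurable_radialDensity.comp (by fun_prop)
        rw [lintegral_mul_const _ hr,
          lintegral_radialDensity_plane]

theorem map_inner_blochLaw {u : EuclideanSpace ℝ (Fin 3)} (hu : ‖u‖ = 1) :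
    Measure.map (fun x => inner ℝ x u) blochLaw = axisLaw := by
  let e : EuclideanSpace ℝ (Fin 3) := EuclideanSpace.single 2 1
  have he : ‖u‖ = ‖e‖ := by simp [e, hu]
  -- The reflection in the plane orthogonal to `u - e` exchanges `u` and `e`.
  let T := (Submodule.span ℝ {u - e})ᗮ.reflection
  have hT : T u = e := Submodule.reflection_sub he
  rw [← map_blochLaw_two, ← map_blochLaw T, Measure.map_map (by fun_prop) (by fun_prop),
    map_blochLaw T]
  congr 1
  ext x
  rw [Function.comp_apply, ← T.inner_map_map, hT,
    show T (T x) = x from Submodule.reflection_reflection _ x]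
  simp [e, EuclideanSpace.inner_single_right]

instance isProbabilityMeasure_axisLaw : IsProbabilityMeasure axisLaw := ⟨axisLaw_univ⟩

instance isProbabilityMeasure_blochLaw : IsProbabilityMeasure blochLaw := by
  refine ⟨?_⟩
  rw [← Set.preimage_univ (f := fun x : EuclideanSpace ℝ (Fin 3) => (x 2 : ℝ)),
    ← Measure.map_apply (by fun_prop) MeasurableSet.univ, map_blochLaw_two, axisLaw_univ]

/-- Cramér–Wold: the characteristic function at `t = ‖t‖ u` is that of the marginal along `u` at
`‖t‖`. Both laws have `axisLaw` as their marginal along every unit vector. -/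
theorem map_outBloch : Measure.map outBloch uniform = blochLaw := by
  have := Measure.isProbabilityMeasure_map (μ := uniform) measurable_outBloch.aemeasurable
  have key : ∀ (μ : Measure (EuclideanSpace ℝ (Fin 3))) (t u : EuclideanSpace ℝ (Fin 3)),
      Measure.map (fun x => inner ℝ x u) μ = axisLaw → t = ‖t‖ • u →
      charFun μ t = charFun axisLaw ‖t‖ := by
    intro μ t u hμ ht
    rw [← hμ, charFun_apply_real, charFun_apply, integral_map (by fun_prop) (by fun_prop)]
    refine integral_congr_ae (.of_forall fun x => ?_)
    simp only
    conv_lhs => rw [ht, inner_smul_right]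
    push_cast
    ring_nf
  refine Measure.ext_of_charFun (funext fun t => ?_)
  obtain ⟨u, hu, ht⟩ : ∃ u : EuclideanSpace ℝ (Fin 3), ‖u‖ = 1 ∧ t = ‖t‖ • u := by
    by_cases h : t = 0
    -- For `t = 0` any unit vector will do.
    · exact ⟨EuclideanSpace.single 2 1, by simp, by simp [h]⟩
    · exact ⟨‖t‖⁻¹ • t, norm_smul_inv_norm h, by
        rw [smul_smul, mul_inv_cancel₀ (norm_ne_zero_iff.2 h), one_smul]⟩
  rw [key _ t u _ ht, key _ t u (map_inner_blochLaw hu) ht]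
  rw [Measure.map_map (by fun_prop) measurable_outBloch]
  exact map_inner_outBloch hu

/-- In polar coordinates the density picks up the area `4πr²` of the sphere, here as `3 · (4π/3) ·
r²`. -/
theorem map_norm_blochLaw : Measure.map (fun x => ‖x‖) blochLaw =
    (volume.restrict (Set.Icc (0 : ℝ) 1)).withDensity (fun r =>
      ENNReal.ofReal (40 * r ^ 2 * (1 - r) ^ 6 * (r ^ 3 + 6 * r ^ 2 + 12 * r + 2))) := by
  refine Measure.ext_of_lintegral _ fun g hg => ?_
  have hm : Measurable fun r : ℝ => ENNReal.ofReal (r ^ (Module.finrank ℝ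
      (EuclideanSpace ℝ (Fin 3)) - 1)) * (radialDensity r * g r) :=
    Measurable.mul (by fun_prop) (measurable_radialDensity.mul hg)
  rw [lintegral_map hg measurable_norm,
    lintegral_blochLaw (g := fun x => g ‖x‖) (hg.comp measurable_norm),
    lintegral_withDensity_eq_lintegral_mul _ (by fun_prop) hg,
    lintegral_fun_norm_addHaar volume (f := fun r => radialDensity r * g r)
      (measurable_radialDensity.mul hg), EuclideanSpace.volume_ball_fin_three,
    ← lintegral_const_mul _ hm,
    setLIntegral_congr Ioc_ae_eq_Icc.symm, ← Set.Ioi_inter_Iic, Set.inter_comm,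
    ← Measure.restrict_restrict measurableSet_Iic, ← lintegral_indicator measurableSet_Iic]
  refine setLIntegral_congr_fun measurableSet_Ioi fun r hr => ?_
  have hr : 0 < r := hr
  simp only [finrank_euclideanSpace, Fintype.card_fin, radialDensity]
  by_cases h : r ∈ Set.Iic (1 : ℝ)
  · have h1 : r ≤ 1 := h
    have hpi := Real.pi_pos
    rw [Set.indicator_of_mem h, Set.indicator_of_mem h, Pi.mul_apply, ← mul_assoc, ← mul_assoc]
    congr 1
    rw [← ENNReal.ofReal_pow zero_le_one, ← ENNReal.ofReal_mul (by positivity),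
      ← ENNReal.ofReal_natCast, ← ENNReal.ofReal_mul (by positivity),
      ← ENNReal.ofReal_mul (by positivity), ← ENNReal.ofReal_mul (by positivity)]
    congr 1
    field_simp
    norm_num
    ring
  · rw [Set.indicator_of_notMem h, Set.indicator_of_notMem h]
    simp

theorem map_toEuclideanLin_blochLaw {O : Matrix (Fin 3) (Fin 3) ℝ}
    (hO : O ∈ Matrix.specialOrthogonalGroup (Fin 3) ℝ) :
    Measure.map (Matrix.toEuclideanLin O) blochLaw = blochLaw := by
  have hO' : O.transpose * O = 1 := by
    have := (Matrix.mem_specialOrthogonalGroup_iff.1 hO).1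
    exact (Matrix.mem_orthogonalGroup_iff' _ _).1 this
  have hnorm : ∀ x, ‖Matrix.toEuclideanLin O x‖ = ‖x‖ := by
    intro x
    rw [← sq_eq_sq₀ (norm_nonneg _) (norm_nonneg _), ← real_inner_self_eq_norm_sq,
      ← real_inner_self_eq_norm_sq, ← LinearMap.adjoint_inner_right,
      ← Matrix.toEuclideanLin_conjTranspose_eq_adjoint]
    congr 1
    ext i
    simp [Matrix.toLpLin_apply, hO']
  let T : EuclideanSpace ℝ (Fin 3) →ₗᵢ[ℝ] EuclideanSpace ℝ (Fin 3) :=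
    ⟨Matrix.toEuclideanLin O, hnorm⟩
  exact map_blochLaw (T.toLinearIsometryEquiv rfl)

end QubitChannel

theorem mainTheorem3 :
    Measure.map (fun p => ‖QubitChannel.outBloch p‖) QubitChannel.uniform =
      (volume.restrict (Set.Icc (0 : ℝ) 1)).withDensity (fun r =>
        ENNReal.ofReal (40 * r ^ 2 * (1 - r) ^ 6 * (r ^ 3 + 6 * r ^ 2 + 12 * r + 2))) ∧
    Measure.map (fun p => QubitChannel.outBloch p 2) QubitChannel.uniform =
      (volume.restrict (Set.Icc (-1 : ℝ) 1)).withDensity (fun z =>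
        ENNReal.ofReal (20 / 11 *
          (z ^ 4 + 7 * |z| ^ 3 + 17 * z ^ 2 + 7 * |z| + 1) * (1 - |z|) ^ 7)) ∧
    ∀ O ∈ Matrix.specialOrthogonalGroup (Fin 3) ℝ,
      Measure.map (fun p => Matrix.toEuclideanLin O (QubitChannel.outBloch p))
          QubitChannel.uniform =
        Measure.map QubitChannel.outBloch QubitChannel.uniform := by
  refine ⟨?_, QubitChannel.map_outBloch_two, fun O hO => ?_⟩
  · rw [← QubitChannel.map_norm_blochLaw, ← QubitChannel.map_outBloch,
      Measure.map_map measurable_norm QubitChannel.measurable_outBloch]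
    rfl
  · have hm : Measurable (Matrix.toEuclideanLin O) :=
      (LinearMap.continuous_of_finiteDimensional _).measurable
    rw [QubitChannel.map_outBloch, ← QubitChannel.map_toEuclideanLin_blochLaw hO,
      ← QubitChannel.map_outBloch, Measure.map_map hm QubitChannel.measurable_outBloch]
    rfl
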